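/- Let $(S,s)$ be a germ of smooth complex analytic surface, with local $\mathbb{C}$-algebra $\mathcal{O}_{S,s}$ of germs of holomorphic functions and maximal ideal $\mathfrak{m}_{S,s}$. A branch on $S$ is an irreducible curve singularity $A=Z(f)$, that is, a principal ideal $(f)$ of $\mathcal{O}_{S,s}$ generated by an irreducible element $f$; let $\mathcal{B}(S)$ be the set of branches. For branches $A=Z(f)$, $B=Z(g)$ let $A\cdot B=\dim_{\mathbb{C}}\mathcal{O}_{S,s}/(f,g)\in\mathbb{N}\cup\{\infty\}$ be the intersection number and $m(A)=\sup\{n:\ f\in\mathfrak{m}_{S,s}^n\}\in\mathbb{N}\cup\{\infty\}$ the multiplicity. A branch $L$ is smooth if $L=Z(x)$ for a local coordinate system $(x,y)$, that is, for a pair $(x,y)$ generating $\mathfrak{m}_{S,s}$. An ultrametric on a set is a metric $d$ on it such that $d(A,B)\le\max\{d(A,C),d(B,C)\}$ for all $A,B,C$. The numbers $A\cdot B$ for $A\neq B$ in $\mathcal{B}(S)$ and $m(A)$ for $A\in\mathcal{B}(S)$ are finite and positive, and: (1) For every smooth branch $L$ on $S$, the function $u_L:(\mathcal{B}(S)\setminus\{L\})^2\to[0,\infty)$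 defined by $$u_L(A,B)=\frac{(L\cdot A)(L\cdot B)}{A\cdot B}\ \text{ if } A\neq B,\qquad u_L(A,A)=0,$$ is an ultrametric on $\mathcal{B}(S)\setminus\{L\}$. (2) Consequently (Płoski's theorem), the function $\mathcal{B}(S)^2\to[0,\infty)$ whose value at $(A,B)$ is $\dfrac{m(A)\,m(B)}{A\cdot B}$ if $A\ne B$ and $0$ otherwise is an ultrametric on $\mathcal{B}(S)$. Equivalently, for any three pairwise distinct branches $A,B,C$ on $S$ one has, up to a permutation of the three fractions, $$\frac{A\cdot B}{m(A)\,m(B)}\ \ge\ \frac{B\cdot C}{m(B)\,m(C)}=\frac{C\cdot A}{m(C)\,m(A)}.$$ -/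

import Mathlib

open scoped Manifold ContDiff Topology

noncomputable section

/-- A function `d : M × M → ℝ` is an ultrametric on the set `M` if it is the distance function of
a metric space structure on `M` that satisfies `d x z ≤ max (d x y) (d y z)`. -/
def IsUltrametric {M : Type*} (d : M → M → ℝ) : Prop :=
  ∃ m : MetricSpace M, (∀ x y : M, m.dist x y = d x y) ∧ @IsUltrametricDist M m.toDist

namespace SurfaceGerm

/-- The model space `ℂ²` of complex analytic surfaces. -/
abbrev Model : Type := EuclideanSpace ℂ (Fin 2)

/-- Germs of complex valued functions form a `ℂ`-algebra, with the pointwise operations. -/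
instance instAlgebraGerm {X : Type*} (l : Filter X) : Algebra ℂ (l.Germ ℂ) :=
  Algebra.ofModule
    (fun c φ ψ => by
      induction φ using Filter.Germ.inductionOn
      induction ψ using Filter.Germ.inductionOn
      simp only [← Filter.Germ.coe_smul, ← Filter.Germ.coe_mul, smul_mul_assoc])
    (fun c φ ψ => by
      induction φ using Filter.Germ.inductionOn
      induction ψ using Filter.Germ.inductionOn
      simp only [← Filter.Germ.coe_smul, ← Filter.Germ.coe_mul, mul_smul_comm])

variable {S : Type*} [TopologicalSpace S] [ChartedSpace Model S]

/-- The local `ℂ`-algebra of germs at `s` of holomorphic functions on the surface `S`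
(over `ℂ`, differentiability of order `ω` at `s` means complex analyticity at `s` in the charts,
hence near `s`). -/
def localRing (s : S) : Subalgebra ℂ ((𝓝 s).Germ ℂ) where
  carrier := {φ | ∃ f : S → ℂ, ContMDiffAt 𝓘(ℂ, Model) 𝓘(ℂ, ℂ) ω f s ∧
    (f : (𝓝 s).Germ ℂ) = φ}
  mul_mem' := by
    rintro _ _ ⟨f, hf, rfl⟩ ⟨g, hg, rfl⟩
    exact ⟨f * g, hf.mul hg, rfl⟩
  add_mem' := by
    rintro _ _ ⟨f, hf, rfl⟩ ⟨g, hg, rfl⟩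
    exact ⟨f + g, hf.add hg, rfl⟩
  algebraMap_mem' c := by
    refine ⟨fun _ => c, contMDiffAt_const, ?_⟩
    rw [Algebra.algebraMap_eq_smul_one]
    change _ = (((c • (1 : S → ℂ)) : S → ℂ) : (𝓝 s).Germ ℂ)
    congr 1
    ext
    simp

/-- The value at `s` of a germ of holomorphic function, as a ring homomorphism. -/
def evalHom (s : S) : localRing s →+* ℂ :=
  Filter.Germ.valueRingHom.comp (localRing s).val.toRingHom

/-- The maximal ideal of the local ring: the germs of holomorphic functions vanishing at `s`. -/
def maxIdeal (s : S) : Ideal (localRing s) :=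
  RingHom.ker (evalHom s)

/-- A local coordinate system at `s`: a pair of germs which generates the maximal ideal. -/
def IsLocalCoordinates {s : S} (x y : localRing s) : Prop :=
  Ideal.span {x, y} = maxIdeal s

/-- A (not necessarily reduced) curve singularity on `(S, s)`, that is, an effective principal
divisor through `s`, given by its ideal in the local ring. -/
@[ext]
structure CurveSingularity (s : S) where
  ideal : Ideal (localRing s)
  exists_generator : ∃ f ∈ maxIdeal s, f ≠ 0 ∧ ideal = Ideal.span {f}

namespace CurveSingularity

variable {s : S}

/-- `f` is a defining function of the curve singularity `C`, that is, `C = Z(f)`. -/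
def IsDefiningFunction (C : CurveSingularity s) (f : localRing s) : Prop :=
  C.ideal = Ideal.span {f}

/-- A branch is a curve singularity which is irreducible (as an effective divisor). -/
def IsBranch (C : CurveSingularity s) : Prop :=
  ∃ f, C.IsDefiningFunction f ∧ Irreducible f

/-- A curve singularity is smooth if it is `Z(x)` for some local coordinate system `(x, y)`. -/
def IsSmooth (C : CurveSingularity s) : Prop :=
  ∃ x y, IsLocalCoordinates x y ∧ C.IsDefiningFunction x

/-- The multiplicity of a curve singularity: the largest `n` such that its defining functions lie
in the `n`-th power of the maximal ideal. -/
def multiplicity (C : CurveSingularity s) : ℕ∞ :=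
  sSup {n : ℕ∞ | ∃ k : ℕ, n = k ∧ C.ideal ≤ maxIdeal s ^ k}

/-- The intersection number `C · D = dim_ℂ 𝒪 / (f, g)`, where `C = Z(f)` and `D = Z(g)`. -/
def inter (C D : CurveSingularity s) : ℕ∞ :=
  Cardinal.toENat (Module.rank ℂ (localRing s ⧸ (C.ideal ⊔ D.ideal)))

/-- The multiplicity may be computed on any defining function. -/
theorem multiplicity_eq {C : CurveSingularity s} {f : localRing s} (h : C.IsDefiningFunction f) :
    C.multiplicity = sSup {n : ℕ∞ | ∃ k : ℕ, n = k ∧ f ∈ maxIdeal s ^ k} := by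
  have h' : C.ideal = Ideal.span {f} := h
  simp only [multiplicity, h', Ideal.span_singleton_le_iff_mem]

end CurveSingularity

/-- The set `ℬ(S)` of branches on the surface germ `(S, s)`. -/
abbrev Branch (s : S) : Type _ := {C : CurveSingularity s // C.IsBranch}

variable {s : S}

/-- The intersection number `A · B` of two branches, as an element of `ℕ ∪ {∞}`. -/
def Branch.inter (A B : Branch s) : ℕ∞ := CurveSingularity.inter A.1 B.1

/-- The multiplicity `m(A)` of a branch, as an element of `ℕ ∪ {∞}`. -/
def Branch.mult (A : Branch s) : ℕ∞ := A.1.multiplicity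

/-- The value `n` of an element of `ℕ ∪ {∞}` known to be finite, as a real number. -/
def real (n : ℕ∞) : ℝ := (n.toNat : ℝ)

open Classical in
/-- The function `u_L` on the set of branches different from `L`. -/
def u (L : Branch s) (A B : {A : Branch s // A ≠ L}) : ℝ :=
  if A = B then 0 else real (L.inter A.1) * real (L.inter B.1) / real (A.1.inter B.1)

open Classical in
/-- The function `(A, B) ↦ m(A) m(B) / (A · B)`, extended by `0` on the diagonal. -/
def ploski (A B : Branch s) : ℝ :=
  if A = B then 0 else real A.mult * real B.mult / real (A.inter B)

/-- The quotient `(A · B) / (m(A) m(B))`. -/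
def quot (A B : Branch s) : ℝ :=
  real (A.inter B) / (real A.mult * real B.mult)

end SurfaceGerm

end

/-!
Let `L = Z(x)` be a smooth branch and `(x, y)` a local coordinate system, so that the local ring
becomes `R = ℂ{x, y}`. By the Weierstrass preparation theorem, a branch other than `L` is defined
by an irreducible distinguished polynomial `P ∈ D[y]`, where `D = ℂ{x}` is a discrete valuation
ring. The integral closure of `D` in an algebraic closure of its field of fractions is a valuation
ring (`isIntegral_or_isIntegral_inv`), because `D` is Henselian, and its valuation `w` is
invariant under conjugation (`valuation_algEquiv`).

The division theorem gives `ℂ{x, y} / (P, Q) = D[y] / (P, Q)`, and the dimension of the latter is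
the order of the norm of `Q` from `D[y] / (P)`. This norm is the product of the `Q(α)` over the
roots `α` of `P`. As these factors are conjugate, `w(x) ^ (A · B) = w(Q(α)) ^ deg P` for every
root `α` of `P`, while `L · A = deg P`. Let the contact of `P` and `Q` be the smallest `w(α - β)`
(with `w` written multiplicatively) over the roots `α` of `P` and `β` of `Q` (`IsContact`). It
satisfies the ultrametric inequality because `w` does, and `w(P(β)) = ∏ w(β - α)` is a monotone
function of the contact, factor by factor (`IsContact.valuation_aeval_le`). So `(L · A) (L · B) /
(A · B)` satisfies the ultrametric inequality as well (`IsWeierstrass.interNumber_ultrametric`).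

For the theorem of Płoski, let `f` define `A` and let `k` be its multiplicity. The initial form of
`f` is not zero on all but finitely many lines `x = c y`, and on such a line `f` has order `k`, so
that `m(A) = L · A` for the corresponding smooth branch `L` (`Branch.exists_mult_eq_inter`). Hence
three given branches admit a common `L` for which the multiplicities are the intersection numbers
with `L`.

The Weierstrass theorems are proved by functional analysis (`exists_division`). For a fixed small
`x`, a function of `y` is represented by the bounded sequence of the coefficients of its power
series, and the multiplication by `f(x, ·)` followed by the backward shift of order `n` is an
analytic family of bounded operators, invertible at `x = 0`.
-/

open scoped Manifold ContDiff Topology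
open Polynomial

noncomputable section

/-! ### Integral closure of a Henselian discrete valuation ring -/

/-- `D` satisfies Hensel's lemma in the following form: every polynomial which does not vanish
modulo `π` is the product of a monic polynomial and of a polynomial with invertible constant
coefficient. -/
def HasMonicFactors {D : Type*} [CommRing D] (π : D) : Prop :=
  ∀ M : D[X], ¬ C π ∣ M → ∃ W N : D[X], M = W * N ∧ W.Monic ∧ IsUnit (N.coeff 0)

section Valuation

variable {D : Type*} [CommRing D] [IsDomain D] [IsDiscreteValuationRing D] {π : D}

theorem exists_eq_C_pow_mul (hπ : Irreducible π) {M : D[X]} (hM : M ≠ 0) :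
    ∃ (k : ℕ) (N : D[X]), M = C π ^ k * N ∧ ¬ C π ∣ N := by
  have hfin : FiniteMultiplicity (C π) M := by
    apply FiniteMultiplicity.of_not_isUnit _ hM
    rw [isUnit_C]
    exact hπ.not_isUnit
  obtain ⟨N, hN, h⟩ := hfin.exists_eq_pow_mul_and_not_dvd
  exact ⟨_, N, hN, h⟩

variable (D) in
/-- An algebraic closure of the field of fractions. -/
abbrev FractionClosure : Type _ := AlgebraicClosure (FractionRing D)

/-- The numerator of a polynomial killing `b` splits into a monic polynomial and a polynomial whose
reverse has an invertible leading coefficient; `b` is a root of one of the two. -/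
theorem isIntegral_or_isIntegral_inv (hπ : Irreducible π) (hD : HasMonicFactors π)
    (b : FractionClosure D) : IsIntegral D b ∨ IsIntegral D b⁻¹ := by
  have hinj : Function.Injective (algebraMap D (FractionClosure D)) := by
    rw [IsScalarTower.algebraMap_eq D (FractionRing D)]
    exact (algebraMap (FractionRing D) _).injective.comp (IsFractionRing.injective D _)
  have halg : IsAlgebraic D b :=
    (IsFractionRing.isAlgebraic_iff D (FractionRing D) (FractionClosure D)).2
      (Algebra.IsAlgebraic.isAlgebraic b)
  obtain ⟨M, hM0, hM⟩ := halg
  obtain ⟨k, M', rfl, hM'⟩ := exists_eq_C_pow_mul hπ hM0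
  obtain ⟨W, N, rfl, hW, hN⟩ := hD M' hM'
  have hπ0 : algebraMap D (FractionClosure D) π ^ k ≠ 0 :=
    pow_ne_zero _ ((map_ne_zero_iff _ hinj).2 hπ.ne_zero)
  simp only [map_mul, map_pow, aeval_C, mul_eq_zero, hπ0, false_or] at hM
  rcases hM with hM | hM
  · exact Or.inl ⟨W, hW, by rwa [aeval_def] at hM⟩
  · right
    by_cases hb : b = 0
    · simp [hb, isIntegral_zero]
    -- the reversed polynomial has an invertible leading coefficient and kills `b⁻¹`
    let _ := invertibleOfNonzero hb
    have hrev : aeval b⁻¹ N.reverse = 0 := by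
      have := (eval₂_reverse_eq_zero_iff (algebraMap D (FractionClosure D)) b N).2 hM
      rwa [invOf_eq_inv] at this
    obtain ⟨u, hu⟩ := hN
    have hlead : N.reverse.leadingCoeff = u := by
      rw [reverse_leadingCoeff, trailingCoeff, natTrailingDegree_eq_zero_of_constantCoeff_ne_zero,
        hu]
      rw [constantCoeff_apply, ← hu]
      exact u.ne_zero
    refine ⟨C ((u⁻¹ : Dˣ) : D) * N.reverse, ?_, ?_⟩
    · rw [Monic, leadingCoeff_mul, leadingCoeff_C, hlead, Units.inv_mul]
    · rw [← aeval_def, map_mul, hrev, mul_zero]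

/-- The integral closure of `D` in the algebraic closure of its field of fractions, as a valuation
ring. -/
def integralValuationSubring (hπ : Irreducible π) (hD : HasMonicFactors π) :
    ValuationSubring (FractionClosure D) where
  toSubring := (integralClosure D (FractionClosure D)).toSubring
  mem_or_inv_mem' := isIntegral_or_isIntegral_inv hπ hD

theorem mem_integralValuationSubring (hπ : Irreducible π) (hD : HasMonicFactors π)
    {b : FractionClosure D} : b ∈ integralValuationSubring hπ hD ↔ IsIntegral D b := Iff.rfl

variable (hπ : Irreducible π) (hD : HasMonicFactors π)

local notation "w" => ValuationSubring.valuation (integralValuationSubring hπ hD)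

theorem valuation_algEquiv_le {a b : FractionClosure D}
    (σ : FractionClosure D ≃ₐ[FractionRing D] FractionClosure D) (h : w a ≤ w b) :
    w (σ a) ≤ w (σ b) := by
  by_cases hb : b = 0
  · simp_all
  have h1 : w (a / b) ≤ 1 := by
    rw [map_div₀]
    exact div_le_one_of_le₀ h zero_le
  rw [ValuationSubring.valuation_le_one_iff, mem_integralValuationSubring] at h1
  have h2 : IsIntegral D (σ (a / b)) := h1.map (σ.restrictScalars D)
  rw [← mem_integralValuationSubring hπ hD, ← ValuationSubring.valuation_le_one_iff, map_div₀,
    map_div₀] at h2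
  have hb' : w (σ b) ≠ 0 := by simpa using hb
  exact (div_le_one₀ (zero_lt_iff.2 hb')).1 h2

theorem valuation_algEquiv_lt {a b : FractionClosure D}
    (σ : FractionClosure D ≃ₐ[FractionRing D] FractionClosure D) (h : w a < w b) :
    w (σ a) < w (σ b) := by
  by_contra! h'
  have := valuation_algEquiv_le hπ hD σ.symm h'
  simp only [AlgEquiv.symm_apply_apply] at this
  exact this.not_gt h

/-- If `σ` decreased the value of `a`, its iterates would be infinitely many conjugates of `a`. -/
theorem not_valuation_algEquiv_lt (σ : FractionClosure D ≃ₐ[FractionRing D] FractionClosure D)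
    (a : FractionClosure D) : ¬ w (σ a) < w a := by
  intro h
  have hanti : StrictAnti fun n : ℕ => w ((σ ^ n) a) := by
    refine strictAnti_nat_of_succ_lt fun n => ?_
    induction n with
    | zero => simpa using h
    | succ n ih =>
      have := valuation_algEquiv_lt hπ hD σ ih
      simpa only [pow_succ', AlgEquiv.mul_apply] using this
  have hfin : ((minpoly (FractionRing D) a).rootSet (FractionClosure D)).Finite :=
    rootSet_finite _ _
  obtain ⟨i, j, hij, h⟩ := hfin.exists_lt_map_eq_of_forall_mem (f := fun n : ℕ => (σ ^ n) a)
    (fun n => by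
      rw [mem_rootSet]
      refine ⟨minpoly.ne_zero (Algebra.IsIntegral.isIntegral a), ?_⟩
      rw [aeval_algHom_apply, minpoly.aeval, map_zero])
  exact (hanti hij).ne (by simp only [h])

theorem valuation_algEquiv (σ : FractionClosure D ≃ₐ[FractionRing D] FractionClosure D)
    (a : FractionClosure D) : w (σ a) = w a := by
  apply le_antisymm
  · have := not_valuation_algEquiv_lt hπ hD σ.symm (σ a)
    simpa using this
  · exact not_lt.1 (not_valuation_algEquiv_lt hπ hD σ a)

theorem valuation_uniformizer_lt_one : w (algebraMap D (FractionClosure D) π) < 1 := by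
  by_contra! h
  have h1 : w (algebraMap D (FractionClosure D) π)⁻¹ ≤ 1 := by
    rw [map_inv₀]
    exact inv_le_one_of_one_le₀ h
  rw [ValuationSubring.valuation_le_one_iff, mem_integralValuationSubring,
    IsScalarTower.algebraMap_apply D (FractionRing D), ← map_inv₀,
    isIntegral_algebraMap_iff (algebraMap (FractionRing D) (FractionClosure D)).injective,
    IsIntegrallyClosed.isIntegral_iff] at h1
  obtain ⟨y, hy⟩ := h1
  have hne : algebraMap D (FractionRing D) π ≠ 0 := by
    simpa using hπ.ne_zero
  have hy' := inv_mul_cancel₀ hne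
  rw [← hy, ← map_mul, map_eq_one_iff _ (IsFractionRing.injective D (FractionRing D))] at hy'
  exact hπ.not_isUnit (IsUnit.of_mul_eq_one _ ((mul_comm _ _).trans hy'))

theorem valuation_algebraMap_le_one (a : D) : w (algebraMap D (FractionClosure D) a) ≤ 1 := by
  rw [ValuationSubring.valuation_le_one_iff, mem_integralValuationSubring]
  exact isIntegral_algebraMap

theorem valuation_unit {u : D} (hu : IsUnit u) : w (algebraMap D (FractionClosure D) u) = 1 := by
  apply le_antisymm (valuation_algebraMap_le_one hπ hD u)
  obtain ⟨v, hv⟩ := hu.exists_right_inv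
  have h := congrArg (fun a => w (algebraMap D (FractionClosure D) a)) hv
  simp only [map_mul, map_one] at h
  rw [← h]
  exact mul_le_of_le_one_right' (valuation_algebraMap_le_one hπ hD v)

theorem valuation_associated {a : D} {k : ℕ} (h : Associated (π ^ k) a) :
    w (algebraMap D (FractionClosure D) a) = w (algebraMap D (FractionClosure D) π) ^ k := by
  obtain ⟨u, rfl⟩ := h
  rw [map_mul, map_pow, map_mul, map_pow, valuation_unit hπ hD u.isUnit, mul_one]

end Valuation

/-! ### Contact of irreducible polynomials -/

section Conjugates

set_option linter.unusedSectionVars false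

variable {D : Type*} [CommRing D] [IsDomain D] [IsDiscreteValuationRing D] {π : D}

theorem exists_algEquiv_of_root {P : D[X]} (hP : P.Monic) (hirr : Irreducible P)
    {α β : FractionClosure D} (hα : aeval α P = 0) (hβ : aeval β P = 0) :
    ∃ σ : FractionClosure D ≃ₐ[FractionRing D] FractionClosure D, σ α = β := by
  have hirr' : Irreducible (P.map (algebraMap D (FractionRing D))) :=
    (hP.irreducible_iff_irreducible_map_fraction_map).1 hirr
  have key : ∀ γ : FractionClosure D, aeval γ P = 0 →
      P.map (algebraMap D (FractionRing D)) = minpoly (FractionRing D) γ := fun γ hγ =>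
    minpoly.eq_of_irreducible_of_monic hirr' (by rwa [aeval_map_algebraMap]) (hP.map _)
  have hconj : IsConjRoot (FractionRing D) α β := (key α hα).symm.trans (key β hβ)
  obtain ⟨σ, hσ⟩ := isConjRoot_iff_exists_algEquiv.1 hconj.symm
  exact ⟨σ, hσ⟩

theorem aeval_algEquiv_eq (σ : FractionClosure D ≃ₐ[FractionRing D] FractionClosure D) (P : D[X])
    (α : FractionClosure D) : aeval (σ α) P = σ (aeval α P) := by
  simpa using aeval_algHom_apply (σ.restrictScalars D).toAlgHom α P

theorem exists_root_fractionClosure {P : D[X]} (hP : P.Monic) (hirr : Irreducible P) :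
    ∃ α : FractionClosure D, aeval α P = 0 := by
  have hirr' : Irreducible (P.map (algebraMap D (FractionRing D))) :=
    (hP.irreducible_iff_irreducible_map_fraction_map).1 hirr
  obtain ⟨α, hα⟩ := IsAlgClosed.exists_aeval_eq_zero (FractionClosure D) _
    (degree_pos_of_irreducible hirr').ne'
  exact ⟨α, by rwa [aeval_map_algebraMap] at hα⟩

theorem mem_aroots_fractionClosure {P : D[X]} (hP : P.Monic) {α : FractionClosure D} :
    α ∈ P.aroots (FractionClosure D) ↔ aeval α P = 0 := by
  rw [mem_aroots', aeval_def]
  exact and_iff_right (hP.map _).ne_zero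

theorem aeval_eq_prod_sub_roots {P : D[X]} (hP : P.Monic) (β : FractionClosure D) :
    aeval β P = ((P.aroots (FractionClosure D)).map fun α => β - α).prod := by
  have h := (IsAlgClosed.splits (P.map (algebraMap D (FractionClosure D)))).eq_prod_roots_of_monic
    (hP.map _)
  have h2 := congrArg (eval β) h
  rw [eval_map_algebraMap, eval_multiset_prod, Multiset.map_map] at h2
  simpa [aroots] using h2

variable (hπ : Irreducible π) (hD : HasMonicFactors π)

local notation "w" => ValuationSubring.valuation (integralValuationSubring hπ hD)

theorem valuation_aeval_root_eq {P : D[X]} (hP : P.Monic) (hirr : Irreducible P) (s : D[X])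
    {α β : FractionClosure D} (hα : aeval α P = 0) (hβ : aeval β P = 0) :
    w (aeval α s) = w (aeval β s) := by
  obtain ⟨σ, rfl⟩ := exists_algEquiv_of_root hP hirr hα hβ
  rw [aeval_algEquiv_eq, valuation_algEquiv]

/-- `κ` is the contact of `P` and `Q`: the smallest value of the differences between a root of `P`
and a root of `Q`. Moreover, every root of one of the two polynomials is at distance `κ` from some
root of the other, as it happens for irreducible polynomials. The valuation is multiplicative, so
that a small `κ` stands for roots which are close to each other. -/
structure IsContact (P Q : D[X]) (κ : (integralValuationSubring hπ hD).ValueGroup) : Prop where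
  le : ∀ α β : FractionClosure D, aeval α P = 0 → aeval β Q = 0 → κ ≤ w (α - β)
  left : ∀ α : FractionClosure D, aeval α P = 0 → ∃ β, aeval β Q = 0 ∧ w (α - β) = κ
  right : ∀ β : FractionClosure D, aeval β Q = 0 → ∃ α, aeval α P = 0 ∧ w (α - β) = κ

/-- The Galois group acts transitively on the roots of `P` and preserves the valuation, so that the
minimum is attained at every root. -/
theorem exists_isContact {P Q : D[X]} (hP : P.Monic) (hPi : Irreducible P) (hQ : Q.Monic)
    (hQi : Irreducible Q) : ∃ κ, IsContact hπ hD P Q κ := by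
  classical
  obtain ⟨α₀, hα₀⟩ := exists_root_fractionClosure hP hPi
  obtain ⟨β₀, hβ₀⟩ := exists_root_fractionClosure hQ hQi
  obtain ⟨⟨α, β⟩, hmem, hmin⟩ := Finset.exists_min_image
    ((P.aroots (FractionClosure D)).toFinset ×ˢ (Q.aroots (FractionClosure D)).toFinset)
    (fun p => w (p.1 - p.2)) ⟨(α₀, β₀), by
      simp only [Finset.mem_product, Multiset.mem_toFinset, mem_aroots_fractionClosure hP,
        mem_aroots_fractionClosure hQ]
      exact ⟨hα₀, hβ₀⟩⟩
  simp only [Finset.mem_product, Multiset.mem_toFinset, mem_aroots_fractionClosure hP,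
    mem_aroots_fractionClosure hQ, Prod.forall] at hmem hmin
  refine ⟨w (α - β), fun a b ha hb => hmin a b ⟨ha, hb⟩, fun a ha => ?_, fun b hb => ?_⟩
  · obtain ⟨σ, rfl⟩ := exists_algEquiv_of_root hP hPi hmem.1 ha
    refine ⟨σ β, by rw [aeval_algEquiv_eq, hmem.2, map_zero], ?_⟩
    rw [← map_sub, valuation_algEquiv]
  · obtain ⟨σ, rfl⟩ := exists_algEquiv_of_root hQ hQi hmem.2 hb
    refine ⟨σ α, by rw [aeval_algEquiv_eq, hmem.1, map_zero], ?_⟩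
    rw [← map_sub, valuation_algEquiv]

variable {hπ hD}

theorem IsContact.symm {P Q : D[X]} {κ} (h : IsContact hπ hD P Q κ) : IsContact hπ hD Q P κ := by
  refine ⟨fun α β hα hβ => ?_, fun α hα => ?_, fun β hβ => ?_⟩
  · rw [Valuation.map_sub_swap]
    exact h.le β α hβ hα
  · obtain ⟨β, hβ, h'⟩ := h.right α hα
    exact ⟨β, hβ, by rw [Valuation.map_sub_swap, h']⟩
  · obtain ⟨α, hα, h'⟩ := h.left β hβ
    exact ⟨α, hα, by rw [Valuation.map_sub_swap, h']⟩

theorem IsContact.le_max {P Q T : D[X]} {κ₁ κ₂ κ₃} (hP : P.Monic) (hPi : Irreducible P)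
    (h₁ : IsContact hπ hD P Q κ₁) (h₂ : IsContact hπ hD Q T κ₂) (h₃ : IsContact hπ hD P T κ₃) :
    κ₃ ≤ max κ₁ κ₂ := by
  obtain ⟨α, hα⟩ := exists_root_fractionClosure hP hPi
  obtain ⟨β, hβ, rfl⟩ := h₁.left α hα
  obtain ⟨γ, hγ, rfl⟩ := h₂.left β hβ
  calc κ₃ ≤ w (α - γ) := h₃.le α γ hα hγ
    _ = w ((α - β) + (β - γ)) := by ring_nf
    _ ≤ _ := Valuation.map_add _ _ _

/-- The value of `P` on the roots of an irreducible polynomial is a monotone function of the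
contact of this polynomial with `P`. -/
theorem IsContact.valuation_aeval_le {P Q T : D[X]} {κ κ'} (hP : P.Monic) (hPi : Irreducible P)
    (hQ : Q.Monic) (hQi : Irreducible Q) (hT : T.Monic) (hTi : Irreducible T)
    (h : IsContact hπ hD P Q κ) (h' : IsContact hπ hD P T κ') (hκ : κ ≤ κ')
    {β γ : FractionClosure D} (hβ : aeval β Q = 0) (hγ : aeval γ T = 0) :
    w (aeval β P) ≤ w (aeval γ P) := by
  obtain ⟨α, hα⟩ := exists_root_fractionClosure hP hPi
  obtain ⟨b, hb, hb'⟩ := h.left α hα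
  obtain ⟨c, hc, hc'⟩ := h'.left α hα
  rw [valuation_aeval_root_eq hπ hD hQ hQi P hβ hb, valuation_aeval_root_eq hπ hD hT hTi P hγ hc,
    aeval_eq_prod_sub_roots hP, aeval_eq_prod_sub_roots hP, map_multiset_prod, map_multiset_prod,
    Multiset.map_map, Multiset.map_map]
  refine Multiset.prod_map_le_prod_map₀ _ _ (fun a _ => zero_le) fun a ha => ?_
  rw [mem_aroots_fractionClosure hP] at ha
  -- both `w (b - α)` and `w (α - a)` are at most `w (c - a)`
  have h1 : κ' ≤ w (c - a) := by
    rw [Valuation.map_sub_swap]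
    exact h'.le a c ha hc
  have h2 : w (α - a) ≤ w (c - a) := by
    calc w (α - a) = w ((α - c) + (c - a)) := by ring_nf
      _ ≤ max (w (α - c)) (w (c - a)) := Valuation.map_add _ _ _
      _ ≤ w (c - a) := max_le (hc'.le.trans h1) le_rfl
  calc w (b - a) = w ((b - α) + (α - a)) := by ring_nf
    _ ≤ max (w (b - α)) (w (α - a)) := Valuation.map_add _ _ _
    _ ≤ w (c - a) := max_le (by rw [Valuation.map_sub_swap, hb']; exact hκ.trans h1) h2

variable (hπ hD)

/-- The norm is the product of the `deg P` conjugates `s(α')`, and they have the same value. -/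
theorem valuation_norm_adjoinRoot [CharZero D] {P : D[X]} (hP : P.Monic) (hirr : Irreducible P)
    (s : D[X]) {α : FractionClosure D} (hα : aeval α P = 0) :
    w (algebraMap D (FractionClosure D) (Algebra.norm D (AdjoinRoot.mk P s))) =
      w (aeval α s) ^ P.natDegree := by
  have : IsDomain (AdjoinRoot P) := AdjoinRoot.isDomain_of_prime hirr.prime
  have := hP.free_adjoinRoot
  have := hP.finite_adjoinRoot
  let K := FractionRing D
  let L := FractionRing (AdjoinRoot P)
  have hdeg : P.degree ≠ 0 := fun h =>
    hirr.not_isUnit (by rw [hP.degree_le_zero_iff_eq_one.1 h.le]; exact isUnit_one)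
  have : FaithfulSMul D L := by
    rw [faithfulSMul_iff_algebraMap_injective, IsScalarTower.algebraMap_eq D (AdjoinRoot P)]
    refine (IsFractionRing.injective (AdjoinRoot P) L).comp ?_
    rw [AdjoinRoot.algebraMap_eq]
    exact AdjoinRoot.of.injective_of_degree_ne_zero hdeg
  let _ := FractionRing.liftAlgebra D L
  have : IsLocalization (Algebra.algebraMapSubmonoid (AdjoinRoot P) (nonZeroDivisors D)) L :=
    inferInstance
  have hfin : FiniteDimensional K L := inferInstance
  have hcard : Module.finrank K L = P.natDegree := by
    rw [IsFractionRing.finrank_eq D K (AdjoinRoot P) L,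
      (AdjoinRoot.powerBasis' hP).finrank, AdjoinRoot.powerBasis'_dim]
  have : CharZero K := IsFractionRing.charZero_of_isFractionRing D
  rw [IsScalarTower.algebraMap_apply D K,
    ← Algebra.norm_localization D (nonZeroDivisors D) (Rₘ := K) (Sₘ := L),
    Algebra.norm_eq_prod_embeddings K (FractionClosure D), map_prod, ← hcard,
    ← AlgHom.card K L (FractionClosure D), ← Finset.card_univ, ← Finset.prod_const]
  refine Finset.prod_congr rfl fun σ _ => ?_
  have h : ∀ s : D[X], σ (algebraMap _ L (AdjoinRoot.mk P s)) =
      aeval (σ (algebraMap _ L (AdjoinRoot.root P))) s := by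
    intro s
    have := aeval_algHom_apply
      ((σ.restrictScalars D).comp (IsScalarTower.toAlgHom D (AdjoinRoot P) L))
      (AdjoinRoot.root P) s
    rw [AdjoinRoot.aeval_eq] at this
    exact this.symm
  rw [h]
  refine valuation_aeval_root_eq hπ hD hP hirr s ?_ hα
  rw [← h, AdjoinRoot.mk_self, map_zero, map_zero]

end Conjugates

/-! ### Intersection numbers -/

theorem span_singleton_eq_of_associated {R : Type*} [CommRing R] {f g : R} (h : Associated f g) :
    Ideal.span {f} = Ideal.span {g} := by
  obtain ⟨u, rfl⟩ := h
  exact (Ideal.span_singleton_mul_right_unit u.isUnit f).symm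

section Length

variable {D : Type*} [CommRing D] [IsDomain D] [IsDiscreteValuationRing D] [Algebra ℂ D] {π : D}

theorem pow_dvd_aeval_iff (hπ : Irreducible π) (k : ℕ) (p : ℂ[X]) :
    π ^ k ∣ aeval π p ↔ X ^ k ∣ p := by
  constructor
  · intro hp
    by_cases hp0 : p = 0
    · simp [hp0]
    obtain ⟨j, q, hq, rfl⟩ : ∃ (j : ℕ) (q : ℂ[X]), ¬ X ∣ q ∧ p = X ^ j * q := by
      obtain ⟨q, hq, h'⟩ := (FiniteMultiplicity.of_not_isUnit not_isUnit_X
        hp0).exists_eq_pow_mul_and_not_dvd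
      exact ⟨_, q, h', hq⟩
    have hunit : IsUnit (aeval π q) := by
      rw [← IsLocalRing.notMem_maximalIdeal, hπ.maximalIdeal_eq, Ideal.mem_span_singleton]
      intro hd
      rw [← q.divX_mul_X_add, map_add, map_mul, aeval_X, aeval_C,
        dvd_add_right (dvd_mul_left _ _)] at hd
      have hq0 : q.coeff 0 ≠ 0 := fun h => hq (X_dvd_iff.2 h)
      exact hπ.not_isUnit (isUnit_of_dvd_unit hd ((IsUnit.mk0 _ hq0).map (algebraMap ℂ D)))
    rw [map_mul, map_pow, aeval_X, hunit.dvd_mul_right,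
      pow_dvd_pow_iff hπ.ne_zero hπ.not_isUnit] at hp
    exact dvd_mul_of_dvd_left (pow_dvd_pow _ hp) _
  · rintro ⟨q, rfl⟩
    rw [map_mul, map_pow, aeval_X]
    exact dvd_mul_right _ _

/-- If `D = ℂ + π D`, then `D ⧸ (π ^ k)` is the quotient of `ℂ[X]` by `X ^ k`. -/
theorem nonempty_quotient_linearEquiv (hπ : Irreducible π)
    (hres : ∀ d : D, ∃ c : ℂ, π ∣ d - algebraMap ℂ D c) {a : D} {k : ℕ}
    (h : Associated (π ^ k) a) :
    Nonempty ((ℂ[X] ⧸ Ideal.span {(X : ℂ[X]) ^ k}) ≃ₗ[ℂ] (D ⧸ Ideal.span {a})) := by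
  have ha : Ideal.span {a} = Ideal.span {π ^ k} :=
    (Ideal.span_singleton_eq_span_singleton.2 h).symm
  rw [ha]
  let φ : ℂ[X] →ₐ[ℂ] D ⧸ Ideal.span {π ^ k} :=
    (Ideal.Quotient.mkₐ ℂ (Ideal.span {π ^ k})).comp (aeval π)
  have happrox : ∀ (j : ℕ) (d : D), ∃ p : ℂ[X], π ^ j ∣ d - aeval π p := by
    intro j
    induction j with
    | zero => exact fun d => ⟨0, by simp⟩
    | succ j ih =>
      intro d
      obtain ⟨p, e, he⟩ := ih d
      obtain ⟨c, e', he'⟩ := hres e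
      refine ⟨p + C c * X ^ j, e', ?_⟩
      simp only [map_add, map_mul, map_pow, aeval_C, aeval_X]
      linear_combination he + π ^ j * he'
  have hsurj : Function.Surjective φ := by
    intro d
    obtain ⟨d, rfl⟩ := Ideal.Quotient.mk_surjective d
    obtain ⟨p, hp⟩ := happrox k d
    refine ⟨p, ?_⟩
    rw [eq_comm]
    exact (Ideal.Quotient.mk_eq_mk_iff_sub_mem _ _).2 (Ideal.mem_span_singleton.2 hp)
  have hker : RingHom.ker φ = Ideal.span {(X : ℂ[X]) ^ k} := by
    ext p
    rw [RingHom.mem_ker, Ideal.mem_span_singleton]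
    change Ideal.Quotient.mk _ (aeval π p) = 0 ↔ _
    rw [Ideal.Quotient.eq_zero_iff_mem, Ideal.mem_span_singleton]
    exact pow_dvd_aeval_iff hπ k p
  exact ⟨((Ideal.quotientEquivAlgOfEq ℂ hker.symm).trans
    (Ideal.quotientKerAlgEquivOfSurjective hsurj)).toLinearEquiv⟩

theorem finite_quotient_of_associated (hπ : Irreducible π)
    (hres : ∀ d : D, ∃ c : ℂ, π ∣ d - algebraMap ℂ D c) {a : D} {k : ℕ}
    (h : Associated (π ^ k) a) : Module.Finite ℂ (D ⧸ Ideal.span {a}) := by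
  obtain ⟨e⟩ := nonempty_quotient_linearEquiv hπ hres h
  have := (monic_X_pow (R := ℂ) k).finite_quotient
  exact Module.Finite.equiv e

theorem finrank_quotient_of_associated (hπ : Irreducible π)
    (hres : ∀ d : D, ∃ c : ℂ, π ∣ d - algebraMap ℂ D c) {a : D} {k : ℕ}
    (h : Associated (π ^ k) a) : Module.finrank ℂ (D ⧸ Ideal.span {a}) = k := by
  obtain ⟨e⟩ := nonempty_quotient_linearEquiv hπ hres h
  rw [← e.finrank_eq, finrank_quotient_span_eq_natDegree, natDegree_X_pow]

/-- The dimension of `S ⧸ (s)` is the order of the norm of `s`: by the Smith normal form, both are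
computed from the elementary divisors of the multiplication by `s`. -/
theorem finite_and_associated_norm {S : Type*} [CommRing S] [IsDomain S] [Algebra D S]
    [Algebra ℂ S] [IsScalarTower ℂ D S] [Module.Free D S] [Module.Finite D S] (hπ : Irreducible π)
    (hres : ∀ d : D, ∃ c : ℂ, π ∣ d - algebraMap ℂ D c) {s : S} (hs : s ≠ 0) :
    Module.Finite ℂ (S ⧸ Ideal.span {s}) ∧
      Associated (π ^ Module.finrank ℂ (S ⧸ Ideal.span {s})) (Algebra.norm D s) := by
  have hI : Ideal.span {s} ≠ ⊥ := Ideal.span_singleton_eq_bot.not.2 hs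
  let b := Module.Free.chooseBasis D S
  have hk : ∀ i, ∃ k : ℕ, Associated (π ^ k) ((Ideal.span {s}).smithCoeffs b hI i) := fun i => by
    obtain ⟨k, hk⟩ := IsDiscreteValuationRing.associated_pow_irreducible
      (Ideal.smithCoeffs_ne_zero b _ hI i) hπ
    exact ⟨k, hk.symm⟩
  choose k hk using hk
  have hfin := fun i => finite_quotient_of_associated hπ hres (hk i)
  refine ⟨Module.Finite.equiv (Ideal.quotientEquivDirectSum ℂ b hI).symm, ?_⟩
  rw [Ideal.finrank_quotient_eq_sum ℂ hI b,
    Finset.sum_congr rfl fun i _ => finrank_quotient_of_associated hπ hres (hk i),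
    ← Finset.prod_pow_eq_pow_sum]
  exact (Associated.prod _ _ _ fun i _ => hk i).trans (associated_norm_prod_smith b hs).symm

end Length

/-- The conclusions of the Weierstrass preparation and division theorems for a ring homomorphism
`Ψ : D[X] → R`, where `π` is a uniformizer of `D`. In the case of interest, `D = ℂ{x}`,
`R = ℂ{x, y}`, `π = x` and `Ψ` maps `X` to `y`. -/
structure IsWeierstrass {D R : Type*} [CommRing D] [CommRing R] (π : D) (Ψ : D[X] →+* R) :
    Prop where
  isUnit_map : ∀ N : D[X], IsUnit (N.coeff 0) → IsUnit (Ψ N)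
  exists_order : ∀ f : R, ¬ Ψ (C π) ∣ f → ∃ (k : ℕ) (u : R), IsUnit u ∧ Ψ (C π) ∣ f - Ψ X ^ k * u
  preparation : ∀ (f u : R) (k : ℕ), IsUnit u → Ψ (C π) ∣ f - Ψ X ^ k * u →
    ∃ P : D[X], P.IsDistinguishedAt (Ideal.span {π}) ∧ P.natDegree = k ∧ Associated f (Ψ P)
  division : ∀ P : D[X], P.IsDistinguishedAt (Ideal.span {π}) → ∀ g : R, ∃ r : D[X], Ψ P ∣ g - Ψ r
  dvd_of_map_dvd : ∀ P : D[X], P.IsDistinguishedAt (Ideal.span {π}) → ∀ r : D[X], Ψ P ∣ Ψ r → P ∣ r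

/-- The intersection number `dim R ⧸ (f, g)` of two elements of a `ℂ`-algebra, which is `0` when the
dimension is infinite. -/
def interNumber {R : Type*} [CommRing R] [Algebra ℂ R] (f g : R) : ℕ :=
  Module.finrank ℂ (R ⧸ (Ideal.span {f} ⊔ Ideal.span {g}))

theorem interNumber_comm {R : Type*} [CommRing R] [Algebra ℂ R] (f g : R) :
    interNumber f g = interNumber g f := by
  rw [interNumber, interNumber, sup_comm]

theorem interNumber_congr {R : Type*} [CommRing R] [Algebra ℂ R] {f f' g g' : R}
    (hf : Associated f f') (hg : Associated g g') : interNumber f g = interNumber f' g' := by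
  rw [interNumber, interNumber, span_singleton_eq_of_associated hf,
    span_singleton_eq_of_associated hg]

namespace IsWeierstrass

variable {D R : Type*} [CommRing D] [CommRing R] {π : D}

section

variable [IsDomain D] [IsDiscreteValuationRing D]

/-- The Weierstrass polynomial `P` of `Ψ M` divides `M`, and the constant coefficient of the
quotient is invertible because the degree of `P` is the order of `M` modulo `π`. -/
theorem hasMonicFactors {Ψ : D[X] →+* R} (h : IsWeierstrass π Ψ) (hπ : Irreducible π) :
    HasMonicFactors π := by
  classical
  intro M hM
  have hunit : ∀ a : D, ¬ π ∣ a ↔ IsUnit a := fun a => by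
    rw [← IsLocalRing.notMem_maximalIdeal, hπ.maximalIdeal_eq, Ideal.mem_span_singleton]
  have hex : ∃ k, ¬ π ∣ M.coeff k := by
    by_contra! h'
    exact hM ((C_dvd_iff_dvd_coeff _ _).2 h')
  obtain ⟨k, hk, hmin⟩ : ∃ k, ¬ π ∣ M.coeff k ∧ ∀ i < k, π ∣ M.coeff i :=
    ⟨Nat.find hex, Nat.find_spec hex, fun i hi => not_not.1 (Nat.find_min hex hi)⟩
  let A : D[X] := ∑ i ∈ Finset.range k, monomial i (M.coeff i)
  have hA : ∀ i, A.coeff i = if i < k then M.coeff i else 0 := fun i => by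
    simp [A, coeff_monomial]
  obtain ⟨U, hU⟩ : X ^ k ∣ M - A := by
    rw [X_pow_dvd_iff]
    intro d hd
    simp [hA, hd]
  have hU0 : U.coeff 0 = M.coeff k := by
    have := congrArg (fun p => p.coeff k) hU
    simp only [coeff_sub, hA, lt_irrefl, if_false, sub_zero] at this
    rw [this, coeff_X_pow_mul']
    simp
  obtain ⟨P, hP, hdeg, hass⟩ := h.preparation (Ψ M) (Ψ U) k
    (h.isUnit_map U (by rw [hU0]; exact (hunit _).1 hk)) (by
      rw [← map_pow, ← map_mul, ← map_sub, ← hU, sub_sub_cancel]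
      refine map_dvd Ψ ((C_dvd_iff_dvd_coeff _ _).2 fun i => ?_)
      rw [hA]
      split_ifs with hi
      · exact hmin i hi
      · exact dvd_zero _)
  obtain ⟨N, rfl⟩ := h.dvd_of_map_dvd P hP M hass.symm.dvd
  refine ⟨P, N, rfl, hP.monic, ?_⟩
  rw [← hunit]
  intro hN
  apply hk
  rw [coeff_mul]
  refine Finset.dvd_sum fun ij hij => ?_
  rw [Finset.HasAntidiagonal.mem_antidiagonal] at hij
  rcases lt_or_eq_of_le (show ij.1 ≤ k by omega) with hi | hi
  · exact dvd_mul_of_dvd_left (Ideal.mem_span_singleton.1 (hP.mem (hdeg ▸ hi))) _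
  · have : ij.2 = 0 := by omega
    rw [this]
    exact dvd_mul_of_dvd_right hN _

theorem irreducible_of_map {Ψ : D[X] →+* R} (h : IsWeierstrass π Ψ) {P : D[X]}
    (hP : P.IsDistinguishedAt (Ideal.span {π})) (hirr : Irreducible (Ψ P)) : Irreducible P := by
  rw [hP.monic.irreducible_iff_natDegree]
  have key : ∀ A B : D[X], A.Monic → B.Monic → A * B = P → IsUnit (Ψ A) → A.natDegree = 0 := by
    intro A B hA hB hAB hu
    have hdvd : P ∣ B := by
      refine h.dvd_of_map_dvd P hP B ?_
      rw [← hAB, map_mul]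
      exact hu.mul_left_dvd.2 dvd_rfl
    have h1 := natDegree_le_of_dvd hdvd hB.ne_zero
    have h2 := hA.natDegree_mul hB
    rw [hAB] at h2
    omega
  refine ⟨fun h1 => hirr.not_isUnit (by rw [h1, map_one]; exact isUnit_one),
    fun A B hA hB hAB => ?_⟩
  rcases hirr.isUnit_or_isUnit (show Ψ P = Ψ A * Ψ B by rw [← map_mul, hAB]) with hu | hu
  · exact Or.inl (key A B hA hB hAB hu)
  · exact Or.inr (key B A hB hA (by rw [mul_comm, hAB]) hu)

end

variable [Algebra ℂ D] [Algebra ℂ R]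

/-- The local ring of the intersection of two curves given by polynomials, the first of them
distinguished, may be computed in the ring of polynomials. -/
theorem nonempty_quotient_linearEquiv {Ψ : D[X] →ₐ[ℂ] R}
    (h : IsWeierstrass π (Ψ : D[X] →+* R)) {P : D[X]}
    (hP : P.IsDistinguishedAt (Ideal.span {π})) (s : D[X]) :
    Nonempty ((AdjoinRoot P ⧸ Ideal.span {AdjoinRoot.mk P s}) ≃ₗ[ℂ]
      (R ⧸ (Ideal.span {Ψ P} ⊔ Ideal.span {Ψ s}))) := by
  let φ : D[X] →ₐ[ℂ] R ⧸ (Ideal.span {Ψ P} ⊔ Ideal.span {Ψ s}) :=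
    (Ideal.Quotient.mkₐ ℂ _).comp Ψ
  let ψ : D[X] →ₐ[ℂ] AdjoinRoot P ⧸ Ideal.span {AdjoinRoot.mk P s} :=
    (Ideal.Quotient.mkₐ ℂ _).comp (Ideal.Quotient.mkₐ ℂ (Ideal.span {P}))
  have hφ : Function.Surjective φ := by
    intro g
    obtain ⟨g, rfl⟩ := Ideal.Quotient.mk_surjective g
    obtain ⟨r, hr⟩ := h.division P hP g
    refine ⟨r, ?_⟩
    rw [eq_comm]
    exact (Ideal.Quotient.mk_eq_mk_iff_sub_mem _ _).2
      (Ideal.mem_sup_left (Ideal.mem_span_singleton.2 hr))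
  have hψ : Function.Surjective ψ :=
    (Ideal.Quotient.mk_surjective).comp Ideal.Quotient.mk_surjective
  have hker : RingHom.ker ψ = RingHom.ker φ := by
    ext t
    rw [RingHom.mem_ker, RingHom.mem_ker]
    change Ideal.Quotient.mk _ (AdjoinRoot.mk P t) = 0 ↔ Ideal.Quotient.mk _ (Ψ t) = 0
    rw [Ideal.Quotient.eq_zero_iff_mem, Ideal.Quotient.eq_zero_iff_mem,
      Ideal.mem_span_singleton, ← Ideal.span_insert, Ideal.mem_span_pair]
    constructor
    · rintro ⟨b, hb⟩
      obtain ⟨b, rfl⟩ := AdjoinRoot.mk_surjective b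
      rw [← map_mul, AdjoinRoot.mk_eq_mk] at hb
      obtain ⟨a, ha⟩ := hb
      refine ⟨Ψ a, Ψ b, ?_⟩
      rw [← map_mul, ← map_mul, ← map_add]
      congr 1
      linear_combination -ha
    · rintro ⟨a, b, hab⟩
      obtain ⟨b', q, hq⟩ := h.division P hP b
      have hdvd : P ∣ t - s * b' := by
        refine h.dvd_of_map_dvd P hP _ ⟨a + q * Ψ s, ?_⟩
        simp only [RingHom.coe_coe, map_sub, map_mul] at hq ⊢
        linear_combination -hab + Ψ s * hq
      refine ⟨AdjoinRoot.mk P b', ?_⟩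
      rw [← map_mul]
      exact AdjoinRoot.mk_eq_mk.2 hdvd
  exact ⟨((Ideal.quotientKerAlgEquivOfSurjective hψ).symm.trans
    ((Ideal.quotientEquivAlgOfEq ℂ hker).trans
    (Ideal.quotientKerAlgEquivOfSurjective hφ))).toLinearEquiv⟩

variable [IsDomain D] [IsDiscreteValuationRing D]

/-- The intersection number with an irreducible distinguished polynomial is the order of a norm. -/
theorem finite_and_associated {Ψ : D[X] →ₐ[ℂ] R} (h : IsWeierstrass π (Ψ : D[X] →+* R))
    (hπ : Irreducible π) (hres : ∀ d : D, ∃ c : ℂ, π ∣ d - algebraMap ℂ D c) {P s : D[X]}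
    (hP : P.IsDistinguishedAt (Ideal.span {π})) (hirr : Irreducible P) (hs : ¬ P ∣ s) :
    Module.Finite ℂ (R ⧸ (Ideal.span {Ψ P} ⊔ Ideal.span {Ψ s})) ∧
      Associated (π ^ interNumber (Ψ P) (Ψ s)) (Algebra.norm D (AdjoinRoot.mk P s)) := by
  obtain ⟨e⟩ := h.nonempty_quotient_linearEquiv hP s
  have : IsDomain (AdjoinRoot P) := AdjoinRoot.isDomain_of_prime hirr.prime
  have := hP.monic.free_adjoinRoot
  have := hP.monic.finite_adjoinRoot
  have hs' : AdjoinRoot.mk P s ≠ 0 := fun h' => hs (AdjoinRoot.mk_eq_zero.1 h')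
  obtain ⟨hfin, hass⟩ := finite_and_associated_norm hπ hres hs'
  refine ⟨Module.Finite.equiv e, ?_⟩
  rwa [interNumber, ← e.finrank_eq]

/-- The intersection number with `x` is the order along `y` modulo `x`. -/
theorem interNumber_eq_order {Ψ : D[X] →ₐ[ℂ] R} (h : IsWeierstrass π (Ψ : D[X] →+* R))
    (hπ : Irreducible π) (hres : ∀ d : D, ∃ c : ℂ, π ∣ d - algebraMap ℂ D c) {f u : R} {k : ℕ}
    (hf : Irreducible f) (hu : IsUnit u) (hk : Ψ (C π) ∣ f - Ψ X ^ k * u) :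
    interNumber f (Ψ (C π)) = k := by
  obtain ⟨P, hP, rfl, hass⟩ := h.preparation f u k hu hk
  have hirr : Irreducible P := h.irreducible_of_map hP (hass.irreducible hf)
  have hdeg : P.natDegree ≠ 0 := fun h0 => hirr.not_isUnit (by
    rw [hP.monic.natDegree_eq_zero.1 h0]
    exact isUnit_one)
  have hnd : ¬ P ∣ C π := fun hd => hdeg (by
    have := natDegree_le_of_dvd hd (C_ne_zero.2 hπ.ne_zero)
    rwa [natDegree_C, nonpos_iff_eq_zero] at this)
  have hnorm := (h.finite_and_associated hπ hres hP hirr hnd).2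
  rw [interNumber_congr hass (Associated.refl _)]
  rw [AdjoinRoot.mk_C, ← AdjoinRoot.algebraMap_eq,
    Algebra.norm_algebraMap_of_basis (AdjoinRoot.powerBasis' hP.monic).basis, Fintype.card_fin,
    AdjoinRoot.powerBasis'_dim] at hnorm
  exact le_antisymm ((pow_dvd_pow_iff hπ.ne_zero hπ.not_isUnit).1 hnorm.dvd)
    ((pow_dvd_pow_iff hπ.ne_zero hπ.not_isUnit).1 hnorm.symm.dvd)

/-- Distinct irreducible curves have a finite intersection number. -/
theorem finite_quotient {Ψ : D[X] →ₐ[ℂ] R} (h : IsWeierstrass π (Ψ : D[X] →+* R))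
    (hπ : Irreducible π) (hres : ∀ d : D, ∃ c : ℂ, π ∣ d - algebraMap ℂ D c) {f g : R}
    (hf : Irreducible f) (hx : ¬ Ψ (C π) ∣ f) (hfg : ¬ f ∣ g) :
    Module.Finite ℂ (R ⧸ (Ideal.span {f} ⊔ Ideal.span {g})) := by
  obtain ⟨k, u, hu, hk⟩ := h.exists_order f hx
  obtain ⟨P, hP, -, hass⟩ := h.preparation f u k hu hk
  have hirr : Irreducible P := h.irreducible_of_map hP (hass.irreducible hf)
  obtain ⟨s, hs⟩ := h.division P hP g
  have hnd : ¬ P ∣ s := fun hd => hfg (by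
    rw [hass.dvd_iff_dvd_left]
    exact (dvd_sub_left (map_dvd Ψ hd)).1 hs)
  have heq : Ideal.span {f} ⊔ Ideal.span {g} = Ideal.span {Ψ P} ⊔ Ideal.span {Ψ s} := by
    rw [span_singleton_eq_of_associated hass, ← Ideal.span_insert, ← Ideal.span_insert]
    obtain ⟨q, hq⟩ := hs
    rw [sub_eq_iff_eq_add, mul_comm] at hq
    refine le_antisymm (Ideal.span_le.2 ?_) (Ideal.span_le.2 ?_)
    · rintro _ (rfl | rfl)
      · exact Ideal.subset_span (Set.mem_insert _ _)
      · exact Ideal.mem_span_pair.2 ⟨q, 1, by rw [hq, one_mul]; rfl⟩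
    · rintro _ (rfl | rfl)
      · exact Ideal.subset_span (Set.mem_insert _ _)
      · refine Ideal.mem_span_pair.2 ⟨-q, 1, ?_⟩
        rw [hq]
        simp
  rw [heq]
  exact (h.finite_and_associated hπ hres hP hirr hnd).1

/-- If the contact of `P` with `Q` is closer than its contact with `T`, then the intersection
numbers, divided by the degrees, compare in the same way. -/
theorem interNumber_mul_le [CharZero D] {Ψ : D[X] →ₐ[ℂ] R} (h : IsWeierstrass π (Ψ : D[X] →+* R))
    (hπ : Irreducible π) (hres : ∀ d : D, ∃ c : ℂ, π ∣ d - algebraMap ℂ D c) {P Q T : D[X]}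
    (hP : P.IsDistinguishedAt (Ideal.span {π})) (hPi : Irreducible P)
    (hQ : Q.IsDistinguishedAt (Ideal.span {π})) (hQi : Irreducible Q)
    (hT : T.IsDistinguishedAt (Ideal.span {π})) (hTi : Irreducible T) (hQP : ¬ Q ∣ P)
    (hTP : ¬ T ∣ P) {κ κ'} (hκ : IsContact hπ (h.hasMonicFactors hπ) P Q κ)
    (hκ' : IsContact hπ (h.hasMonicFactors hπ) P T κ') (hle : κ ≤ κ') :
    interNumber (Ψ P) (Ψ T) * Q.natDegree ≤ interNumber (Ψ P) (Ψ Q) * T.natDegree := by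
  obtain ⟨β, hβ⟩ := exists_root_fractionClosure hQ.monic hQi
  obtain ⟨γ, hγ⟩ := exists_root_fractionClosure hT.monic hTi
  have hD := h.hasMonicFactors hπ
  have hval := hκ.valuation_aeval_le hP.monic hPi hQ.monic hQi hT.monic hTi hκ' hle hβ hγ
  have h1 := valuation_associated hπ hD (h.finite_and_associated hπ hres hQ hQi hQP).2
  have h2 := valuation_associated hπ hD (h.finite_and_associated hπ hres hT hTi hTP).2
  rw [valuation_norm_adjoinRoot hπ hD hQ.monic hQi P hβ] at h1
  rw [valuation_norm_adjoinRoot hπ hD hT.monic hTi P hγ] at h2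
  have h3 := pow_le_pow_left₀ zero_le hval (Q.natDegree * T.natDegree)
  rw [pow_mul, h1, mul_comm Q.natDegree, pow_mul, h2, ← pow_mul, ← pow_mul] at h3
  have hpos : 0 < (integralValuationSubring hπ hD).valuation
      (algebraMap D (FractionClosure D) π) := by
    rw [zero_lt_iff, Valuation.ne_zero_iff, IsScalarTower.algebraMap_apply D (FractionRing D)]
    simpa using hπ.ne_zero
  rw [pow_le_pow_iff_right_of_lt_one₀ hpos (valuation_uniformizer_lt_one hπ hD)] at h3
  rwa [interNumber_comm (Ψ P), interNumber_comm (Ψ P)]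

/-- The ultrametric inequality for the intersection numbers divided by the intersection numbers
with `x`. -/
theorem interNumber_ultrametric [CharZero D] {Ψ : D[X] →ₐ[ℂ] R}
    (h : IsWeierstrass π (Ψ : D[X] →+* R))
    (hπ : Irreducible π) (hres : ∀ d : D, ∃ c : ℂ, π ∣ d - algebraMap ℂ D c) {f₁ f₂ f₃ : R}
    (hf₁ : Irreducible f₁) (hf₂ : Irreducible f₂) (hf₃ : Irreducible f₃)
    (hx₁ : ¬ Ψ (C π) ∣ f₁) (hx₂ : ¬ Ψ (C π) ∣ f₂) (hx₃ : ¬ Ψ (C π) ∣ f₃)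
    (h₁₂ : ¬ Associated f₁ f₂) (h₂₃ : ¬ Associated f₂ f₃) (h₁₃ : ¬ Associated f₁ f₃) :
    interNumber f₁ f₂ * interNumber (Ψ (C π)) f₃ ≤ interNumber f₁ f₃ * interNumber (Ψ (C π)) f₂ ∨
    interNumber f₂ f₃ * interNumber (Ψ (C π)) f₁ ≤
      interNumber f₁ f₃ * interNumber (Ψ (C π)) f₂ := by
  have aux : ∀ f : R, Irreducible f → ¬ Ψ (C π) ∣ f → ∃ P : D[X],
      P.IsDistinguishedAt (Ideal.span {π}) ∧ Irreducible P ∧ Associated f (Ψ P) ∧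
      interNumber (Ψ (C π)) f = P.natDegree := by
    intro f hf hx
    obtain ⟨k, u, hu, hk⟩ := h.exists_order f hx
    obtain ⟨P, hP, hdeg, hass⟩ := h.preparation f u k hu hk
    exact ⟨P, hP, h.irreducible_of_map hP (hass.irreducible hf), hass, by
      rw [hdeg, interNumber_comm, h.interNumber_eq_order hπ hres hf hu hk]⟩
  obtain ⟨P, hP, hPi, hPf, hn₁⟩ := aux f₁ hf₁ hx₁
  obtain ⟨Q, hQ, hQi, hQf, hn₂⟩ := aux f₂ hf₂ hx₂
  obtain ⟨T, hT, hTi, hTf, hn₃⟩ := aux f₃ hf₃ hx₃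
  have ndvd : ∀ {A B : D[X]} {a b : R}, Irreducible A → Irreducible B → Associated a (Ψ A) →
      Associated b (Ψ B) → ¬ Associated a b → ¬ A ∣ B := fun hA hB ha hb hab hd =>
    hab (ha.trans ((Associated.map Ψ (hA.associated_of_dvd hB hd)).trans hb.symm))
  obtain ⟨κ₁₂, hκ₁₂⟩ := exists_isContact hπ (h.hasMonicFactors hπ) hP.monic hPi hQ.monic hQi
  obtain ⟨κ₂₃, hκ₂₃⟩ := exists_isContact hπ (h.hasMonicFactors hπ) hQ.monic hQi hT.monic hTi
  obtain ⟨κ₁₃, hκ₁₃⟩ := exists_isContact hπ (h.hasMonicFactors hπ) hP.monic hPi hT.monic hTi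
  rw [interNumber_congr hPf hQf, interNumber_congr hPf hTf, interNumber_congr hQf hTf, hn₁, hn₂,
    hn₃]
  rcases le_max_iff.1 (hκ₁₂.le_max hP.monic hPi hκ₂₃ hκ₁₃) with hle | hle
  · left
    exact h.interNumber_mul_le hπ hres hP hPi hT hTi hQ hQi
      (ndvd hTi hPi hTf hPf fun h' => h₁₃ h'.symm) (ndvd hQi hPi hQf hPf fun h' => h₁₂ h'.symm)
      hκ₁₃ hκ₁₂ hle
  · right
    rw [interNumber_comm (Ψ Q), interNumber_comm (Ψ P)]
    exact h.interNumber_mul_le hπ hres hT hTi hP hPi hQ hQi (ndvd hPi hTi hPf hTf h₁₃)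
      (ndvd hQi hTi hQf hTf h₂₃) hκ₁₃.symm hκ₂₃.symm hle

end IsWeierstrass

/-! ### Germs of analytic functions -/

section Germs

/-- Composition of germs with a function, as a homomorphism of algebras. -/
def germComp {X Y : Type*} {l : Filter X} {l' : Filter Y} (g : X → Y) (hg : Filter.Tendsto g l l') :
    l'.Germ ℂ →ₐ[ℂ] l.Germ ℂ where
  toFun φ := φ.compTendsto g hg
  map_one' := rfl
  map_zero' := rfl
  map_mul' φ ψ := by
    induction φ using Filter.Germ.inductionOn
    induction ψ using Filter.Germ.inductionOn
    rfl
  map_add' φ ψ := by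
    induction φ using Filter.Germ.inductionOn
    induction ψ using Filter.Germ.inductionOn
    rfl
  commutes' c := by
    rw [Algebra.algebraMap_eq_smul_one, Algebra.algebraMap_eq_smul_one]
    rfl

variable (E : Type*) [NormedAddCommGroup E] [NormedSpace ℂ E]

/-- The algebra of germs at the origin of analytic functions on a normed space. -/
def analyticGerms : Subalgebra ℂ ((𝓝 (0 : E)).Germ ℂ) where
  carrier := {φ | ∃ f : E → ℂ, AnalyticAt ℂ f 0 ∧ (f : (𝓝 (0 : E)).Germ ℂ) = φ}
  mul_mem' := by
    rintro _ _ ⟨f, hf, rfl⟩ ⟨g, hg, rfl⟩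
    exact ⟨f * g, hf.mul hg, rfl⟩
  add_mem' := by
    rintro _ _ ⟨f, hf, rfl⟩ ⟨g, hg, rfl⟩
    exact ⟨f + g, hf.add hg, rfl⟩
  algebraMap_mem' c := by
    refine ⟨c • (1 : E → ℂ), analyticAt_const (v := c • (1 : ℂ)), ?_⟩
    rw [Algebra.algebraMap_eq_smul_one]
    rfl

namespace analyticGerms

variable {E} {F : Type*} [NormedAddCommGroup F] [NormedSpace ℂ F]

/-- The germ at the origin of an analytic function. -/
def mk (f : E → ℂ) (hf : AnalyticAt ℂ f 0) : analyticGerms E := ⟨f, f, hf, rfl⟩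

theorem exists_mk (φ : analyticGerms E) : ∃ (f : E → ℂ) (hf : AnalyticAt ℂ f 0), φ = mk f hf := by
  obtain ⟨_, f, hf, rfl⟩ := φ
  exact ⟨f, hf, rfl⟩

theorem mk_eq_mk {f g : E → ℂ} {hf : AnalyticAt ℂ f 0} {hg : AnalyticAt ℂ g 0} :
    mk f hf = mk g hg ↔ f =ᶠ[𝓝 0] g := by
  rw [Subtype.ext_iff]
  exact Filter.Germ.coe_eq

theorem mk_mul {f g : E → ℂ} (hf : AnalyticAt ℂ f 0) (hg : AnalyticAt ℂ g 0) :
    mk f hf * mk g hg = mk (f * g) (hf.mul hg) := rfl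

theorem mk_add {f g : E → ℂ} (hf : AnalyticAt ℂ f 0) (hg : AnalyticAt ℂ g 0) :
    mk f hf + mk g hg = mk (f + g) (hf.add hg) := rfl

theorem mk_pow {f : E → ℂ} (hf : AnalyticAt ℂ f 0) (n : ℕ) :
    mk f hf ^ n = mk (f ^ n) (hf.pow n) := rfl

theorem mk_eq_zero {f : E → ℂ} {hf : AnalyticAt ℂ f 0} : mk f hf = 0 ↔ f =ᶠ[𝓝 0] 0 :=
  mk_eq_mk (hg := analyticAt_const)

theorem algebraMap_eq (c : ℂ) :
    algebraMap ℂ (analyticGerms E) c = mk (fun _ => c) analyticAt_const := by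
  rw [Algebra.algebraMap_eq_smul_one]
  refine Subtype.ext ?_
  change (((c • (1 : E → ℂ)) : E → ℂ) : (𝓝 (0 : E)).Germ ℂ) = _
  congr 1
  ext
  simp

/-- The value of a germ at the origin. -/
def value : analyticGerms E →ₐ[ℂ] ℂ where
  toRingHom := Filter.Germ.valueRingHom.comp (analyticGerms E).val.toRingHom
  commutes' c := by
    rw [algebraMap_eq]
    rfl

@[simp]
theorem value_mk {f : E → ℂ} (hf : AnalyticAt ℂ f 0) : value (mk f hf) = f 0 := rfl

theorem isUnit_iff {φ : analyticGerms E} : IsUnit φ ↔ value φ ≠ 0 := by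
  constructor
  · exact fun h => (h.map value).ne_zero
  · obtain ⟨f, hf, rfl⟩ := exists_mk φ
    intro h
    refine IsUnit.of_mul_eq_one (mk (fun z => (f z)⁻¹) (hf.inv h)) ?_
    rw [mk_mul]
    refine (mk_eq_mk (hg := analyticAt_const (v := (1 : ℂ)))).2 ?_
    filter_upwards [hf.continuousAt.eventually_ne h] with z hz
    simp [mul_inv_cancel₀ hz]

/-- Composition with an analytic map that fixes the origin. -/
def comp (g : E → F) (hg : AnalyticAt ℂ g 0) (hg0 : g 0 = 0) :
    analyticGerms F →ₐ[ℂ] analyticGerms E :=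
  AlgHom.codRestrict ((germComp g (by
      have := hg.continuousAt.tendsto
      rwa [hg0] at this)).comp (analyticGerms F).val)
    (analyticGerms E) (by
      rintro ⟨_, f, hf, rfl⟩
      exact ⟨f ∘ g, AnalyticAt.comp (by rwa [hg0]) hg, rfl⟩)

/-- The coordinate on the line. -/
def coord : analyticGerms ℂ := mk id analyticAt_id

theorem exists_eq_pow_mul {φ : analyticGerms ℂ} (hφ : φ ≠ 0) :
    ∃ (n : ℕ) (u : analyticGerms ℂ), IsUnit u ∧ φ = coord ^ n * u := by
  obtain ⟨f, hf, rfl⟩ := exists_mk φ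
  have hne : ¬ ∀ᶠ z in 𝓝 (0 : ℂ), f z = 0 := fun h => hφ (mk_eq_zero.2 h)
  obtain ⟨n, g, hg, hg0, hfg⟩ := hf.exists_eventuallyEq_pow_smul_nonzero_iff.2 hne
  refine ⟨n, mk g hg, isUnit_iff.2 hg0, ?_⟩
  rw [coord, mk_pow, mk_mul]
  refine mk_eq_mk.2 ?_
  filter_upwards [hfg] with z hz
  simpa using hz

theorem coord_mul_eq_zero {φ : analyticGerms ℂ} (h : coord * φ = 0) : φ = 0 := by
  obtain ⟨f, hf, rfl⟩ := exists_mk φ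
  rw [coord, mk_mul, mk_eq_zero] at h
  rw [mk_eq_zero]
  have h1 : ∀ᶠ z in 𝓝[≠] (0 : ℂ), f z = 0 := by
    filter_upwards [h.filter_mono nhdsWithin_le_nhds, self_mem_nhdsWithin] with z hz hz0
    simpa [show z ≠ 0 from hz0] using hz
  exact hf.frequently_zero_iff_eventually_zero.1 h1.frequently

theorem coord_pow_mul_eq_zero {φ : analyticGerms ℂ} (n : ℕ) (h : coord ^ n * φ = 0) : φ = 0 := by
  induction n with
  | zero => simpa using h
  | succ n ih =>
    rw [pow_succ', mul_assoc] at h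
    exact ih (coord_mul_eq_zero h)

instance : Nontrivial (analyticGerms E) := (value (E := E)).toRingHom.domain_nontrivial

instance : IsDomain (analyticGerms ℂ) := by
  have : NoZeroDivisors (analyticGerms ℂ) := ⟨fun {φ ψ} h => by
    by_contra! hne
    obtain ⟨n, u, hu, rfl⟩ := exists_eq_pow_mul hne.1
    rw [mul_assoc] at h
    exact hne.2 (hu.mul_right_eq_zero.1 (coord_pow_mul_eq_zero n h))⟩
  exact NoZeroDivisors.to_isDomain _

theorem value_coord : value coord = 0 := rfl

theorem coord_dvd_iff {φ : analyticGerms ℂ} : coord ∣ φ ↔ value φ = 0 := by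
  constructor
  · rintro ⟨ψ, rfl⟩
    rw [map_mul, value_coord, zero_mul]
  · intro h
    by_cases hφ : φ = 0
    · simp [hφ]
    obtain ⟨n, u, hu, rfl⟩ := exists_eq_pow_mul hφ
    cases n with
    | zero =>
      rw [pow_zero, one_mul] at h
      exact absurd h (isUnit_iff.1 hu)
    | succ n => exact dvd_mul_of_dvd_left (dvd_pow_self _ n.succ_ne_zero) _

theorem irreducible_coord : Irreducible coord := by
  refine ⟨fun h => isUnit_iff.1 h value_coord, fun φ ψ h => ?_⟩
  by_contra! hne
  obtain ⟨a, rfl⟩ := coord_dvd_iff.2 (not_not.1 (mt isUnit_iff.2 hne.1))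
  obtain ⟨b, rfl⟩ := coord_dvd_iff.2 (not_not.1 (mt isUnit_iff.2 hne.2))
  have h0 : coord * (1 - a * coord * b) = 0 := by linear_combination h
  have h1 := congrArg value (coord_mul_eq_zero h0)
  simp [value_coord] at h1

instance : IsDiscreteValuationRing (analyticGerms ℂ) :=
  IsDiscreteValuationRing.ofHasUnitMulPowIrreducibleFactorization
    ⟨coord, irreducible_coord, fun {φ} hφ => by
      obtain ⟨n, u, hu, rfl⟩ := exists_eq_pow_mul hφ
      exact ⟨n, hu.unit, rfl⟩⟩

instance : CharZero (analyticGerms ℂ) :=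
  charZero_of_injective_algebraMap (algebraMap ℂ (analyticGerms ℂ)).injective

theorem exists_coord_dvd_sub (φ : analyticGerms ℂ) :
    ∃ c : ℂ, coord ∣ φ - algebraMap ℂ (analyticGerms ℂ) c :=
  ⟨value φ, coord_dvd_iff.2 (by simp)⟩

end analyticGerms

end Germs

/-! ### Analytic families of operators on sequences of coefficients -/

theorem analyticAt_clm_apply {E F G : Type*} [NormedAddCommGroup E] [NormedSpace ℂ E]
    [NormedAddCommGroup F] [NormedSpace ℂ F] [NormedAddCommGroup G] [NormedSpace ℂ G]
    {T : E → F →L[ℂ] G} {p : E → F} {x : E} (hT : AnalyticAt ℂ T x) (hp : AnalyticAt ℂ p x) :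
    AnalyticAt ℂ (fun z => T z (p z)) x :=
  AnalyticAt.fun_comp ((ContinuousLinearMap.id ℂ (F →L[ℂ] G)).analyticAt_bilinear _)
    (AnalyticAt.prod hT hp)

theorem analyticAt_clm_comp {E F G H : Type*} [NormedAddCommGroup E] [NormedSpace ℂ E]
    [NormedAddCommGroup F] [NormedSpace ℂ F] [NormedAddCommGroup G] [NormedSpace ℂ G]
    [NormedAddCommGroup H] [NormedSpace ℂ H] {T : E → G →L[ℂ] H} {U : E → F →L[ℂ] G} {x : E}
    (hT : AnalyticAt ℂ T x) (hU : AnalyticAt ℂ U x) :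
    AnalyticAt ℂ (fun z => (T z).comp (U z)) x :=
  AnalyticAt.fun_comp ((ContinuousLinearMap.compL ℂ F G H).analyticAt_bilinear _)
    (AnalyticAt.prod hT hU)

section Sequences

open BoundedContinuousFunction

/-- The Banach space of bounded sequences of complex numbers, viewed as sequences of coefficients of
power series in one variable. -/
abbrev CoeffSeq : Type := ℕ →ᵇ ℂ

namespace CoeffSeq

/-- The backward shift, which corresponds to `p ↦ (p - p(0)) / t`. -/
def back : CoeffSeq →L[ℂ] CoeffSeq :=
  LinearMap.mkContinuous
    { toFun := fun p => p.compContinuous ⟨Nat.succ, continuous_of_discreteTopology⟩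
      map_add' := fun _ _ => rfl
      map_smul' := fun _ _ => rfl } 1 fun p => by
    rw [one_mul, norm_le (norm_nonneg _)]
    exact fun k => p.norm_coe_le_norm _

/-- The forward shift, which corresponds to the multiplication by `t`. -/
def shift : CoeffSeq →L[ℂ] CoeffSeq :=
  LinearMap.mkContinuous
    { toFun := fun p => ofNormedAddCommGroupDiscrete
        (fun k => match k with | 0 => 0 | k + 1 => p k) ‖p‖ (by
          rintro (_ | k)
          · simp
          · exact p.norm_coe_le_norm k)
      map_add' := fun p q => by
        ext k
        cases k <;> simp
      map_smul' := fun c p => by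
        ext k
        cases k <;> simp } 1 fun p => by
    rw [one_mul, norm_le (norm_nonneg _)]
    rintro (_ | k)
    · simp
    · exact p.norm_coe_le_norm k

/-- The sequence of coefficients of the constant power series `1`. -/
def one : CoeffSeq :=
  ofNormedAddCommGroupDiscrete (fun k => if k = 0 then 1 else 0) 1 (by
    intro k
    split_ifs <;> simp)

theorem back_apply (p : CoeffSeq) (k : ℕ) : back p k = p (k + 1) := rfl

theorem back_pow_apply (p : CoeffSeq) (n k : ℕ) : (back ^ n) p k = p (k + n) := by
  induction n generalizing p with
  | zero => rfl
  | succ n ih =>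
    rw [pow_succ, mul_apply_eq_comp, ih, back_apply, add_assoc]

theorem shift_apply_zero (p : CoeffSeq) : shift p 0 = 0 := rfl

theorem back_shift (p : CoeffSeq) : back (shift p) = p := by
  ext k
  rfl

theorem back_pow_shift_pow (n : ℕ) (p : CoeffSeq) : (back ^ n) ((shift ^ n) p) = p := by
  induction n with
  | zero => rfl
  | succ n ih =>
    rw [pow_succ back, pow_succ' shift, mul_apply_eq_comp, mul_apply_eq_comp, back_shift, ih]

theorem norm_back_le : ‖back‖ ≤ 1 := LinearMap.mkContinuous_norm_le _ zero_le_one _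

theorem norm_shift_le : ‖shift‖ ≤ 1 := LinearMap.mkContinuous_norm_le _ zero_le_one _

theorem norm_shift_pow_le (n : ℕ) : ‖shift ^ n‖ ≤ 1 := by
  induction n with
  | zero => exact ContinuousLinearMap.norm_id_le
  | succ n ih =>
    rw [pow_succ]
    exact (norm_mul_le _ _).trans (mul_le_one₀ ih (norm_nonneg _) norm_shift_le)

/-- The sum `∑ p k * t ^ k` of the power series with coefficients `p`, for `‖t‖ < 1`. It is encoded
as the constant coefficient of the resolvent of the backward shift, which makes its analyticity in
`t` immediate; the value is a junk value if `1 - t • back` is not invertible. -/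
def sum (t : ℂ) : CoeffSeq →L[ℂ] ℂ :=
  (evalCLM ℂ 0).comp (Ring.inverse (1 - t • back))

theorem sum_eq {t : ℂ} (ht : ‖t‖ < 1) (p : CoeffSeq) : sum t p = p 0 + t * sum t (back p) := by
  have hlt : ‖t • back‖ < 1 := by
    rw [norm_smul]
    exact (mul_le_of_le_one_right (norm_nonneg _) norm_back_le).trans_lt ht
  have hu : IsUnit (1 - t • back) :=
    isUnit_one_sub_of_norm_lt_one (R := CoeffSeq →L[ℂ] CoeffSeq) hlt
  have h1 : Ring.inverse (1 - t • back) * (1 - t • back) = 1 :=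
    Ring.inverse_mul_cancel _ hu
  have h2 : Ring.inverse (1 - t • back) p = p + t • Ring.inverse (1 - t • back) (back p) := by
    have := congrArg (fun T : CoeffSeq →L[ℂ] CoeffSeq => T p) h1
    simp only [mul_apply_eq_comp, _root_.sub_apply,
      one_apply_eq_self, _root_.smul_apply, map_sub, map_smul] at this
    rw [sub_eq_iff_eq_add] at this
    exact this
  simp only [sum, ContinuousLinearMap.comp_apply]
  rw [h2, map_add, map_smul]
  rfl

theorem sum_shift {t : ℂ} (ht : ‖t‖ < 1) (p : CoeffSeq) : sum t (shift p) = t * sum t p := by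
  rw [sum_eq ht, shift_apply_zero, back_shift, zero_add]

theorem sum_shift_pow {t : ℂ} (ht : ‖t‖ < 1) (p : CoeffSeq) (n : ℕ) :
    sum t ((shift ^ n) p) = t ^ n * sum t p := by
  induction n generalizing p with
  | zero => simp
  | succ n ih => rw [pow_succ, mul_apply_eq_comp, ih, sum_shift ht]; ring

theorem sum_one {t : ℂ} (ht : ‖t‖ < 1) : sum t one = 1 := by
  have h : back one = 0 := by
    ext k
    simp [back_apply, one]
  rw [sum_eq ht, h, ContinuousLinearMap.map_zero, mul_zero, add_zero]
  simp [one]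

theorem sum_eq_truncation {t : ℂ} (ht : ‖t‖ < 1) (p : CoeffSeq) (n : ℕ) :
    sum t p = ∑ j ∈ Finset.range n, p j * t ^ j + t ^ n * sum t ((back ^ n) p) := by
  induction n with
  | zero => simp
  | succ n ih =>
    rw [ih, Finset.sum_range_succ, sum_eq ht ((back ^ n) p), back_pow_apply, zero_add,
      pow_succ' back, mul_apply_eq_comp]
    ring

theorem analyticAt_sum : AnalyticAt ℂ (fun t => sum t) 0 := by
  have h1 : AnalyticAt ℂ (fun t : ℂ => t • back) 0 := analyticAt_id.smul analyticAt_const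
  have h2 : AnalyticAt ℂ (fun T : CoeffSeq →L[ℂ] CoeffSeq => Ring.inverse (1 - T))
      ((0 : ℂ) • back) := by
    rw [zero_smul ℂ back]
    exact analyticAt_inverse_one_sub ℂ (CoeffSeq →L[ℂ] CoeffSeq)
  exact analyticAt_clm_comp analyticAt_const
    (AnalyticAt.fun_comp (f := fun t : ℂ => t • back) h2 h1)

/-- A power series that vanishes near the origin has no nonzero coefficient. -/
theorem eq_zero_of_sum_eq_zero {p : CoeffSeq} (h : ∀ᶠ t in 𝓝 (0 : ℂ), sum t p = 0) : p = 0 := by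
  have hlt : ∀ᶠ t in 𝓝 (0 : ℂ), ‖t‖ < 1 := by
    filter_upwards [Metric.ball_mem_nhds (0 : ℂ) one_pos] with t ht using by simpa using ht
  have key : ∀ n : ℕ, ∀ᶠ t in 𝓝 (0 : ℂ), sum t ((back ^ n) p) = 0 := by
    intro n
    induction n with
    | zero => simpa using h
    | succ n ih =>
      have h0 : p n = 0 := by
        have := ih.self_of_nhds
        rw [sum_eq (by simp), back_pow_apply] at this
        simpa using this
      have han : AnalyticAt ℂ (fun t => sum t ((back ^ (n + 1)) p)) 0 :=
        analyticAt_clm_apply analyticAt_sum analyticAt_const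
      refine han.frequently_zero_iff_eventually_zero.1 (Filter.Eventually.frequently ?_)
      filter_upwards [ih.filter_mono nhdsWithin_le_nhds, hlt.filter_mono nhdsWithin_le_nhds,
        self_mem_nhdsWithin] with t ht ht1 ht0
      rw [sum_eq ht1, back_pow_apply, zero_add, h0, zero_add, ← mul_apply_eq_comp,
        ← pow_succ'] at ht
      exact (mul_eq_zero.1 ht).resolve_left ht0
  ext n
  have := (key n).self_of_nhds
  rw [sum_eq (by simp), back_pow_apply] at this
  simpa using this

/-- An analytic function of two variables is the sum of an absolutely convergent double power
series on small bidiscs. -/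
theorem exists_eq_tsum {f : ℂ × ℂ → ℂ} (hf : AnalyticAt ℂ f 0) : ∃ r₀ > 0, ∃ c : ℕ × ℕ → ℂ,
    ∀ r, 0 < r → r < r₀ → (Summable fun k => ‖c k‖ * (r ^ k.1 * r ^ k.2)) ∧
      ∀ x y : ℂ, ‖x‖ < r → ‖y‖ < r → f (x, y) = ∑' k : ℕ × ℕ, c k * (x ^ k.1 * y ^ k.2) := by
  obtain ⟨P, R, hP⟩ := hf
  obtain ⟨ρ, hρ0, hρR⟩ := ENNReal.lt_iff_exists_nnreal_btwn.1 hP.r_pos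
  let d : ℕ × ℕ → ℂ := fun k => P.changeOriginSeries k.1 k.2 (fun _ => (1, 0)) (fun _ => (0, 1))
  refine ⟨ρ / 2, by simpa using hρ0, d ∘ Prod.swap, fun r hr hrρ => ?_⟩
  lift r to NNReal using hr.le
  have hrad : (r + r : ENNReal) < P.radius := by
    refine lt_of_le_of_lt ?_ (hρR.trans_le hP.r_le)
    rw [← ENNReal.coe_add, ENNReal.coe_le_coe, ← NNReal.coe_le_coe, NNReal.coe_add]
    linarith
  have hdle : ∀ k : ℕ × ℕ,
      ‖d k‖₊ ≤ ∑' _ : { s : Finset (Fin (k.1 + k.2)) // s.card = k.2 }, ‖P (k.1 + k.2)‖₊ := by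
    intro k
    refine le_trans ?_ (P.nnnorm_changeOriginSeries_le_tsum k.1 k.2)
    refine (ContinuousMultilinearMap.le_opNNNorm _ _).trans ?_
    have h1 : ∏ _i : Fin k.1, ‖((0, 1) : ℂ × ℂ)‖₊ = 1 := by simp [Prod.nnnorm_def]
    rw [h1, mul_one]
    refine (ContinuousMultilinearMap.le_opNNNorm _ _).trans ?_
    have h2 : ∏ _i : Fin k.2, ‖((1, 0) : ℂ × ℂ)‖₊ = 1 := by simp [Prod.nnnorm_def]
    rw [h2, mul_one]
  have hsumd : Summable fun k : ℕ × ℕ => ‖d k‖₊ * (r ^ k.2 * r ^ k.1) := by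
    have h1 := (Equiv.sigmaAssoc fun k l : ℕ => { s : Finset (Fin (k + l)) // s.card = l })
      |>.summable_iff.2 (P.changeOriginSeries_summable_aux₁ hrad)
    have h2 := ((Equiv.sigmaEquivProd ℕ ℕ).symm.summable_iff.2 (NNReal.summable_sigma.1 h1).2)
    refine NNReal.summable_of_le (fun k => ?_) h2
    simp only [Function.comp_def, Equiv.sigmaAssoc, Equiv.coe_fn_mk, mul_assoc,
      NNReal.tsum_mul_right, Equiv.sigmaEquivProd_symm_apply]
    exact mul_le_mul_left (hdle k) _
  have hsumd' : Summable fun k : ℕ × ℕ => ‖d k‖ * ((r : ℝ) ^ k.2 * (r : ℝ) ^ k.1) := by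
    simpa using NNReal.summable_coe.2 hsumd
  refine ⟨(Equiv.prodComm ℕ ℕ).summable_iff.2 hsumd', fun x y hx hy => ?_⟩
  have hX : ‖((x, 0) : ℂ × ℂ)‖₊ = ‖x‖₊ := by simp [Prod.nnnorm_def]
  have hY : ‖((0, y) : ℂ × ℂ)‖₊ = ‖y‖₊ := by simp [Prod.nnnorm_def]
  have hxr : ‖x‖₊ < r := hx
  have hyr : ‖y‖₊ < r := hy
  have hxy : (‖((x, 0) : ℂ × ℂ)‖₊ + ‖((0, y) : ℂ × ℂ)‖₊ : ENNReal) < P.radius := by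
    rw [hX, hY]
    refine lt_of_le_of_lt ?_ hrad
    gcongr
  have hfP : f (x, y) = P.sum ((x, 0) + (0, y)) := by
    have h1 : ((x, 0) + (0, y) : ℂ × ℂ) ∈ Metric.eball (0 : ℂ × ℂ) R := by
      rw [mem_eball_zero_iff]
      refine lt_of_le_of_lt ?_ hρR
      rw [Prod.mk_add_mk, add_zero, zero_add, enorm_eq_nnnorm, Prod.nnnorm_def, ENNReal.coe_le_coe]
      refine max_le (hxr.le.trans ?_) (hyr.le.trans ?_) <;>
      · rw [← NNReal.coe_le_coe]
        linarith [ρ.coe_nonneg]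
    have := hP.sum h1
    rw [zero_add] at this
    rw [← this]
    simp
  have hpt : ∀ k : ℕ × ℕ, P.changeOriginSeries k.1 k.2 (fun _ => (x, 0)) (fun _ => (0, y)) =
      d k * (x ^ k.2 * y ^ k.1) := by
    intro k
    have hx1 : (fun _ : Fin k.2 => ((x, 0) : ℂ × ℂ)) = fun _ => x • ((1, 0) : ℂ × ℂ) := by simp
    have hy1 : (fun _ : Fin k.1 => ((0, y) : ℂ × ℂ)) = fun _ => y • ((0, 1) : ℂ × ℂ) := by simp
    rw [hx1, hy1, ContinuousMultilinearMap.map_smul_univ, ContinuousMultilinearMap.map_smul_univ]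
    simp only [Finset.prod_const, Finset.card_univ, Fintype.card_fin,
      _root_.smul_apply, smul_eq_mul, d]
    ring
  have hterm : Summable fun k : ℕ × ℕ => d k * (x ^ k.2 * y ^ k.1) := by
    refine Summable.of_norm_bounded hsumd' fun k => ?_
    rw [norm_mul, norm_mul, norm_pow, norm_pow]
    gcongr
  have hinner : ∀ j : ℕ, HasSum (fun i : ℕ => d (j, i) * (x ^ i * y ^ j))
      (P.changeOrigin (x, 0) j fun _ => (0, y)) := by
    intro j
    have hball : ((x, 0) : ℂ × ℂ) ∈ Metric.eball (0 : ℂ × ℂ) P.radius := by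
      rw [mem_eball_zero_iff]
      exact (le_add_right le_rfl).trans_lt hxy
    have h1 := (P.hasFPowerSeriesOnBall_changeOrigin j (bot_le.trans_lt hrad)).hasSum hball
    rw [zero_add] at h1
    have h2 := ContinuousMultilinearMap.hasSum_eval h1 (fun _ => ((0, y) : ℂ × ℂ))
    exact h2.congr_fun fun i => (hpt (j, i)).symm
  rw [hfP, ← P.changeOrigin_eval hxy, FormalMultilinearSeries.sum]
  rw [show (∑' k : ℕ × ℕ, (d ∘ Prod.swap) k * (x ^ k.1 * y ^ k.2)) =
    ∑' k : ℕ × ℕ, d k * (x ^ k.2 * y ^ k.1) from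
      (Equiv.prodComm ℕ ℕ).tsum_eq fun k : ℕ × ℕ => d k * (x ^ k.2 * y ^ k.1)]
  rw [hterm.tsum_prod' fun j => (hinner j).summable]
  exact tsum_congr fun j => (hinner j).tsum_eq.symm

/-- Multiplication by an analytic function `f` of two variables, as an analytic family of operators
on the sequences of coefficients of power series in the second variable. -/
theorem exists_mulOperator {f : ℂ × ℂ → ℂ} (hf : AnalyticAt ℂ f 0) : ∃ r₀ > 0, ∀ r : ℝ, 0 < r →
    r < r₀ → ∃ F : ℂ → CoeffSeq →L[ℂ] CoeffSeq, AnalyticAt ℂ F 0 ∧ ∀ x : ℂ, ‖x‖ < r → ∀ t : ℂ,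
      ‖t‖ < 1 → ∀ p, sum t (F x p) = f (x, r * t) * sum t p := by
  obtain ⟨r₀, hr₀, c, hc⟩ := exists_eq_tsum hf
  refine ⟨r₀, hr₀, fun r hr hrr₀ => ?_⟩
  obtain ⟨hsum, hfc⟩ := hc r hr hrr₀
  let term : ℕ × ℕ → ℂ → CoeffSeq →L[ℂ] CoeffSeq := fun k x =>
    (c k * (x ^ k.1 * (r : ℂ) ^ k.2)) • shift ^ k.2
  have hle : ∀ (k : ℕ × ℕ) (x : ℂ), x ∈ Metric.ball (0 : ℂ) r →
      ‖term k x‖ ≤ ‖c k‖ * (r ^ k.1 * r ^ k.2) := by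
    intro k x hx
    rw [mem_ball_zero_iff] at hx
    rw [norm_smul]
    refine (mul_le_of_le_one_right (norm_nonneg _) (norm_shift_pow_le _)).trans ?_
    rw [norm_mul, norm_mul, norm_pow, norm_pow, Complex.norm_real, Real.norm_of_nonneg hr.le]
    gcongr
  refine ⟨fun x => ∑' k, term k x, ?_, fun x hx t ht p => ?_⟩
  · have hd : DifferentiableOn ℂ (fun x => ∑' k, term k x) (Metric.ball (0 : ℂ) r) := by
      refine Complex.differentiableOn_tsum_of_summable_norm (E := CoeffSeq →L[ℂ] CoeffSeq) hsum
        (fun k => ?_) Metric.isOpen_ball hle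
      fun_prop
    exact hd.analyticAt (Metric.ball_mem_nhds _ hr)
  · have hs : Summable fun k => term k x :=
      Summable.of_norm_bounded hsum fun k => hle k x (by simpa using hx)
    have h1 : sum t ((∑' k, term k x) p) = ∑' k, sum t (term k x p) :=
      ((sum t).comp (ContinuousLinearMap.apply ℂ CoeffSeq p)).map_tsum hs
    have hrt : ‖(r : ℂ) * t‖ < r := by
      rw [norm_mul, Complex.norm_real, Real.norm_of_nonneg hr.le]
      exact mul_lt_of_lt_one_right hr ht
    rw [h1, hfc x _ hx hrt, ← tsum_mul_right]
    refine tsum_congr fun k => ?_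
    simp only [term, _root_.smul_apply, map_smul, smul_eq_mul, sum_shift_pow ht]
    ring

end CoeffSeq

open CoeffSeq

/-- An analytic function of two variables that vanishes on the line `x = 0` is divisible by `x`. -/
theorem exists_eq_fst_mul {f : ℂ × ℂ → ℂ} (hf : AnalyticAt ℂ f 0)
    (h0 : ∀ᶠ y in 𝓝 (0 : ℂ), f (0, y) = 0) :
    ∃ h : ℂ × ℂ → ℂ, AnalyticAt ℂ h 0 ∧ ∀ᶠ z in 𝓝 (0 : ℂ × ℂ), f z = z.1 * h z := by
  obtain ⟨r₀, hr₀, hF⟩ := exists_mulOperator hf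
  obtain ⟨F, hF, hFf⟩ := hF (r₀ / 2) (by positivity) (by linarith)
  set r : ℝ := r₀ / 2
  have hr : 0 < r := by positivity
  have hrC : (r : ℂ) ≠ 0 := by exact_mod_cast hr.ne'
  let φ : ℂ → CoeffSeq := fun x => F x one
  have hφ : AnalyticAt ℂ φ 0 := analyticAt_clm_apply hF analyticAt_const
  have hφ0 : φ 0 = 0 := by
    apply eq_zero_of_sum_eq_zero
    have hlim : Filter.Tendsto (fun t : ℂ => (r : ℂ) * t) (𝓝 0) (𝓝 0) := by
      have : Continuous fun t : ℂ => (r : ℂ) * t := by fun_prop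
      simpa using this.tendsto 0
    filter_upwards [hlim.eventually h0, Metric.ball_mem_nhds (0 : ℂ) one_pos] with t ht ht1
    rw [hFf 0 (by simpa using hr) t (by simpa using ht1), ht, zero_mul]
  obtain ⟨P, hP⟩ := hφ
  have hslope : AnalyticAt ℂ (dslope φ 0) 0 := ⟨_, hP.has_fpower_series_dslope_fslope⟩
  refine ⟨fun z => sum (z.2 / r) (dslope φ 0 z.1), ?_, ?_⟩
  · refine analyticAt_clm_apply ?_ ?_
    · refine AnalyticAt.fun_comp (f := fun z : ℂ × ℂ => z.2 / (r : ℂ)) ?_ ?_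
      · simpa using analyticAt_sum
      · exact analyticAt_snd.div_const
    · exact AnalyticAt.fun_comp (f := fun z : ℂ × ℂ => z.1) hslope analyticAt_fst
  · filter_upwards [Metric.ball_mem_nhds (0 : ℂ × ℂ) hr] with z hz
    rw [mem_ball_zero_iff, Prod.norm_def, max_lt_iff] at hz
    have ht : ‖z.2 / (r : ℂ)‖ < 1 := by
      rw [norm_div, Complex.norm_real, Real.norm_of_nonneg hr.le, div_lt_one hr]
      exact hz.2
    have h1 := sub_smul_dslope φ 0 z.1
    rw [sub_zero, hφ0, sub_zero] at h1
    have h2 := hFf z.1 hz.1 _ ht one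
    rw [sum_one ht, mul_one, mul_div_cancel₀ _ hrC] at h2
    rw [← h2, ← smul_eq_mul, ← map_smul, h1]

/-! ### Weierstrass division -/

/-- The Weierstrass division theorem. The coefficients of the quotient `q(x, ·)` are
`T x⁻¹ (back ^ n (g(x, ·)))`, where `T x` is the multiplication by `f(x, ·)` followed by the removal
of the first `n` coefficients; `T 0` is invertible, hence so is `T x` for small `x`. -/
theorem exists_division {f g : ℂ × ℂ → ℂ} (hf : AnalyticAt ℂ f 0) (hg : AnalyticAt ℂ g 0) {n : ℕ}
    {e : ℂ → ℂ} (he : AnalyticAt ℂ e 0) (he0 : e 0 ≠ 0)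
    (hfe : ∀ᶠ y in 𝓝 (0 : ℂ), f (0, y) = y ^ n * e y) :
    ∃ (q : ℂ × ℂ → ℂ) (a : ℕ → ℂ → ℂ), AnalyticAt ℂ q 0 ∧ (∀ j, AnalyticAt ℂ (a j) 0) ∧
      ∀ᶠ z in 𝓝 (0 : ℂ × ℂ), g z = q z * f z + ∑ j ∈ Finset.range n, a j z.1 * z.2 ^ j := by
  have he₁ : AnalyticAt ℂ (fun z : ℂ × ℂ => e z.2) 0 :=
    AnalyticAt.fun_comp (f := fun z : ℂ × ℂ => z.2) he analyticAt_snd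
  have he₂ : AnalyticAt ℂ (fun z : ℂ × ℂ => (e z.2)⁻¹) 0 := he₁.inv he0
  obtain ⟨r₁, hr₁, hF⟩ := exists_mulOperator hf
  obtain ⟨r₂, hr₂, hG⟩ := exists_mulOperator hg
  obtain ⟨r₃, hr₃, hE⟩ := exists_mulOperator he₁
  obtain ⟨r₄, hr₄, hE'⟩ := exists_mulOperator he₂
  obtain ⟨r, hr, hr'⟩ := exists_between (show 0 < min (min r₁ r₂) (min r₃ r₄) by positivity)
  simp only [lt_min_iff] at hr'
  obtain ⟨F, hF, hFf⟩ := hF r hr hr'.1.1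
  obtain ⟨G, hG, hGg⟩ := hG r hr hr'.1.2
  obtain ⟨E, -, hE⟩ := hE r hr hr'.2.1
  obtain ⟨E', -, hE'⟩ := hE' r hr hr'.2.2
  have hrC : (r : ℂ) ≠ 0 := by exact_mod_cast hr.ne'
  have h0r : ‖(0 : ℂ)‖ < r := by simpa using hr
  have hlim : Filter.Tendsto (fun t : ℂ => (r : ℂ) * t) (𝓝 0) (𝓝 0) := by
    have : Continuous fun t : ℂ => (r : ℂ) * t := by fun_prop
    simpa using this.tendsto 0
  have hne : ∀ᶠ t in 𝓝 (0 : ℂ), e (r * t) ≠ 0 :=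
    hlim.eventually (he.continuousAt.eventually_ne he0)
  have hball : ∀ᶠ t in 𝓝 (0 : ℂ), ‖t‖ < 1 := by
    filter_upwards [Metric.ball_mem_nhds (0 : ℂ) one_pos] with t ht using by simpa using ht
  have ext : ∀ p q : CoeffSeq, (∀ᶠ t in 𝓝 (0 : ℂ), sum t p = sum t q) → p = q := by
    intro p q h
    rw [← sub_eq_zero]
    refine eq_zero_of_sum_eq_zero ?_
    filter_upwards [h] with t ht
    rw [map_sub, ht, sub_self]
  -- on the line `x = 0`, the multiplication by `f / y ^ n` is invertible
  have hEE' : E 0 * E' 0 = 1 := by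
    ext1 p
    refine ext _ _ ?_
    filter_upwards [hne, hball] with t ht ht1
    rw [mul_apply_eq_comp, hE 0 h0r t ht1, hE' 0 h0r t ht1, mul_inv_cancel_left₀ ht]
    rfl
  have hE'E : E' 0 * E 0 = 1 := by
    ext1 p
    refine ext _ _ ?_
    filter_upwards [hne, hball] with t ht ht1
    rw [mul_apply_eq_comp, hE' 0 h0r t ht1, hE 0 h0r t ht1, inv_mul_cancel_left₀ ht]
    rfl
  have hF0 : ∀ p, F 0 p = (shift ^ n) ((r : ℂ) ^ n • E 0 p) := by
    intro p
    refine ext _ _ ?_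
    filter_upwards [hlim.eventually hfe, hball] with t ht ht1
    rw [hFf 0 h0r t ht1, ht, sum_shift_pow ht1, map_smul, hE 0 h0r t ht1, smul_eq_mul]
    ring
  let T : ℂ → CoeffSeq →L[ℂ] CoeffSeq := fun x => (back ^ n).comp (F x)
  have hT : AnalyticAt ℂ T 0 := analyticAt_clm_comp analyticAt_const hF
  have hT0 : T 0 = (r : ℂ) ^ n • E 0 := by
    ext1 p
    change (back ^ n) (F 0 p) = _
    rw [hF0, back_pow_shift_pow]
    rfl
  have hTu : IsUnit (T 0) := by
    rw [hT0]
    have hc : (r : ℂ) ^ n ≠ 0 := pow_ne_zero _ hrC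
    refine ⟨⟨(r : ℂ) ^ n • E 0, ((r : ℂ) ^ n)⁻¹ • E' 0, ?_, ?_⟩, rfl⟩
    · ext1 p
      change (r : ℂ) ^ n • E 0 (((r : ℂ) ^ n)⁻¹ • E' 0 p) = p
      rw [map_smul, smul_inv_smul₀ hc]
      exact congrArg (fun T : CoeffSeq →L[ℂ] CoeffSeq => T p) hEE'
    · ext1 p
      change ((r : ℂ) ^ n)⁻¹ • E' 0 ((r : ℂ) ^ n • E 0 p) = p
      rw [map_smul, inv_smul_smul₀ hc]
      exact congrArg (fun T : CoeffSeq →L[ℂ] CoeffSeq => T p) hE'E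
  obtain ⟨U, hU⟩ := hTu
  have hinv : AnalyticAt ℂ (fun x => Ring.inverse (T x)) 0 :=
    AnalyticAt.fun_comp (by
      rw [← hU]
      exact analyticAt_inverse (𝕜 := ℂ) (A := CoeffSeq →L[ℂ] CoeffSeq) U) hT
  have hunit : ∀ᶠ x in 𝓝 (0 : ℂ), IsUnit (T x) :=
    hT.continuousAt.eventually (by
      rw [← hU]
      exact (Units.isOpen (R := CoeffSeq →L[ℂ] CoeffSeq)).mem_nhds U.isUnit)
  let p : ℂ → CoeffSeq := fun x => Ring.inverse (T x) ((back ^ n) (G x one))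
  have hGone : AnalyticAt ℂ (fun x => G x one) 0 := analyticAt_clm_apply hG analyticAt_const
  have hp : AnalyticAt ℂ p 0 :=
    analyticAt_clm_apply hinv (analyticAt_clm_apply analyticAt_const hGone)
  let h : ℂ → CoeffSeq := fun x => G x one - F x (p x)
  have hh : AnalyticAt ℂ h 0 := hGone.sub (analyticAt_clm_apply hF hp)
  refine ⟨fun z => sum (z.2 / r) (p z.1), fun j x => h x j * ((r : ℂ)⁻¹) ^ j, ?_, fun j => ?_, ?_⟩
  · refine analyticAt_clm_apply ?_ ?_
    · refine AnalyticAt.fun_comp (f := fun z : ℂ × ℂ => z.2 / (r : ℂ)) ?_ ?_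
      · simpa using analyticAt_sum
      · exact analyticAt_snd.div_const
    · exact AnalyticAt.fun_comp (f := fun z : ℂ × ℂ => z.1) hp analyticAt_fst
  · exact (analyticAt_clm_apply
      (analyticAt_const (v := BoundedContinuousFunction.evalCLM ℂ j)) hh).mul analyticAt_const
  · have hunit' : ∀ᶠ z in 𝓝 (0 : ℂ × ℂ), IsUnit (T z.1) :=
      (continuous_fst.tendsto (0 : ℂ × ℂ)).eventually hunit
    filter_upwards [Metric.ball_mem_nhds (0 : ℂ × ℂ) hr, hunit'] with z hz hzu
    rw [mem_ball_zero_iff, Prod.norm_def, max_lt_iff] at hz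
    have ht : ‖z.2 / (r : ℂ)‖ < 1 := by
      rw [norm_div, Complex.norm_real, Real.norm_of_nonneg hr.le, div_lt_one hr]
      exact hz.2
    have hback : (back ^ n) (h z.1) = 0 := by
      have h1 : T z.1 (p z.1) = (back ^ n) (G z.1 one) := by
        change (T z.1 * Ring.inverse (T z.1)) _ = _
        rw [Ring.mul_inverse_cancel _ hzu]
        rfl
      rw [map_sub, ← h1]
      exact sub_self _
    have h2 := sum_eq_truncation ht (h z.1) n
    rw [hback, ContinuousLinearMap.map_zero, mul_zero, add_zero, map_sub, hGg z.1 hz.1 _ ht,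
      hFf z.1 hz.1 _ ht, sum_one ht, mul_one, mul_div_cancel₀ _ hrC] at h2
    rw [sub_eq_iff_eq_add] at h2
    rw [h2, add_comm, mul_comm (f z)]
    congr 1
    refine Finset.sum_congr rfl fun j _ => ?_
    rw [div_pow, inv_pow]
    ring

end Sequences

/-! ### Germs of analytic functions on the plane -/

namespace analyticGerms

theorem mk_sum {E : Type*} [NormedAddCommGroup E] [NormedSpace ℂ E] {ι : Type*} (s : Finset ι)
    {f : ι → E → ℂ} (hf : ∀ i, AnalyticAt ℂ (f i) 0) :
    ∑ i ∈ s, mk (f i) (hf i) =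
      mk (fun z => ∑ i ∈ s, f i z) (Finset.analyticAt_fun_sum s fun i _ => hf i) := by
  classical
  induction s using Finset.induction_on with
  | empty => rfl
  | insert i s hi ih =>
    rw [Finset.sum_insert hi, ih, mk_add]
    refine mk_eq_mk.2 (Filter.Eventually.of_forall fun z => ?_)
    simp [Finset.sum_insert hi]

/-- The first coordinate on the plane. -/
def fst : analyticGerms (ℂ × ℂ) := mk Prod.fst analyticAt_fst

/-- The second coordinate on the plane. -/
def snd : analyticGerms (ℂ × ℂ) := mk Prod.snd analyticAt_snd

/-- The restriction of germs to the line `x = 0`. -/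
def restrict : analyticGerms (ℂ × ℂ) →ₐ[ℂ] analyticGerms ℂ :=
  comp (fun y => (0, y)) (AnalyticAt.prod analyticAt_const analyticAt_id) rfl

/-- The inclusion of `ℂ{x}[y]` in `ℂ{x, y}`. -/
def ofPolynomial : (analyticGerms ℂ)[X] →ₐ[ℂ] analyticGerms (ℂ × ℂ) where
  toRingHom := eval₂RingHom (comp Prod.fst analyticAt_fst rfl).toRingHom snd
  commutes' c := by
    rw [Polynomial.algebraMap_apply]
    exact (eval₂_C _ _).trans ((comp Prod.fst analyticAt_fst rfl).commutes c)

theorem ofPolynomial_C (a : analyticGerms ℂ) :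
    ofPolynomial (C a) = comp Prod.fst analyticAt_fst rfl a :=
  eval₂_C _ _

theorem ofPolynomial_C_coord : ofPolynomial (C coord) = fst := ofPolynomial_C coord

theorem ofPolynomial_X : ofPolynomial X = snd :=
  eval₂_X _ _

theorem restrict_fst : restrict fst = 0 := rfl

theorem restrict_snd : restrict snd = coord := rfl

theorem restrict_ofPolynomial (N : (analyticGerms ℂ)[X]) :
    restrict (ofPolynomial N) =
      aeval coord (N.map (value : analyticGerms ℂ →ₐ[ℂ] ℂ).toRingHom) := by
  have h : (restrict.comp ofPolynomial).toRingHom =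
      (aeval coord : ℂ[X] →ₐ[ℂ] analyticGerms ℂ).toRingHom.comp
        (mapRingHom (value : analyticGerms ℂ →ₐ[ℂ] ℂ).toRingHom) := by
    refine Polynomial.ringHom_ext (fun a => ?_) ?_
    · obtain ⟨f, hf, rfl⟩ := exists_mk a
      simp only [AlgHom.toRingHom_eq_coe, RingHom.coe_coe, AlgHom.comp_apply, ofPolynomial_C,
        RingHom.comp_apply, coe_mapRingHom, map_C, aeval_C, value_mk]
      rw [algebraMap_eq]
      rfl
    · simp only [AlgHom.toRingHom_eq_coe, RingHom.coe_coe, AlgHom.comp_apply, ofPolynomial_X,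
        RingHom.comp_apply, coe_mapRingHom, map_X, aeval_X]
      rfl
  exact congrArg (fun φ : (analyticGerms ℂ)[X] →+* analyticGerms ℂ => φ N) h

theorem fst_dvd_iff {φ : analyticGerms (ℂ × ℂ)} : fst ∣ φ ↔ restrict φ = 0 := by
  constructor
  · rintro ⟨ψ, rfl⟩
    rw [map_mul, restrict_fst, zero_mul]
  · obtain ⟨f, hf, rfl⟩ := exists_mk φ
    intro h
    obtain ⟨g, hg, hfg⟩ := exists_eq_fst_mul hf ((mk_eq_zero
      (hf := AnalyticAt.fun_comp (f := fun y : ℂ => ((0, y) : ℂ × ℂ)) hf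
        (AnalyticAt.prod analyticAt_const analyticAt_id))).1 h)
    exact ⟨mk g hg, (mk_eq_mk (hg := analyticAt_fst.mul hg)).2 hfg⟩

theorem fst_mul_eq_zero {φ : analyticGerms (ℂ × ℂ)} (h : fst * φ = 0) : φ = 0 := by
  obtain ⟨f, hf, rfl⟩ := exists_mk φ
  rw [fst, mk_mul, mk_eq_zero] at h
  rw [mk_eq_zero]
  filter_upwards [hf.eventually_analyticAt, eventually_eventually_nhds.2 h] with z hz h0
  by_contra hne
  have h1 : ∀ᶠ w in 𝓝 z, w.1 = 0 := by
    filter_upwards [hz.continuousAt.eventually_ne hne, h0] with w hw hw0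
    exact (mul_eq_zero.1 hw0).resolve_right hw
  have h2 : Filter.Tendsto (fun t : ℂ => (z.1 + t, z.2)) (𝓝 0) (𝓝 z) := by
    have : Continuous fun t : ℂ => (z.1 + t, z.2) := by fun_prop
    simpa using this.tendsto 0
  have h3 : ∀ᶠ t in 𝓝[≠] (0 : ℂ), False := by
    filter_upwards [(h2.eventually h1).filter_mono nhdsWithin_le_nhds, self_mem_nhdsWithin]
      with t ht ht0
    rw [h1.self_of_nhds, zero_add] at ht
    exact ht0 ht
  exact h3.exists.elim fun _ h => h

theorem fst_mul_cancel {φ ψ : analyticGerms (ℂ × ℂ)} (h : fst * φ = fst * ψ) : φ = ψ := by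
  rw [← sub_eq_zero] at h ⊢
  exact fst_mul_eq_zero (by rw [mul_sub, h])

theorem value_restrict (φ : analyticGerms (ℂ × ℂ)) : value (restrict φ) = value φ := by
  obtain ⟨f, hf, rfl⟩ := exists_mk φ
  rfl

/-- The Weierstrass division theorem for germs: the remainder is a polynomial in `y`. -/
theorem exists_eq_mul_add {φ : analyticGerms (ℂ × ℂ)} {u : analyticGerms ℂ} (hu : IsUnit u) {n : ℕ}
    (hφ : restrict φ = coord ^ n * u) (ψ : analyticGerms (ℂ × ℂ)) :
    ∃ (q : analyticGerms (ℂ × ℂ)) (r : (analyticGerms ℂ)[X]), r.degree < n ∧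
      ψ = q * φ + ofPolynomial r := by
  obtain ⟨f, hf, rfl⟩ := exists_mk φ
  obtain ⟨g, hg, rfl⟩ := exists_mk ψ
  obtain ⟨e, he, rfl⟩ := exists_mk u
  rw [coord, mk_pow, mk_mul] at hφ
  obtain ⟨q, a, hq, ha, h⟩ := exists_division hf hg he (isUnit_iff.1 hu)
    ((mk_eq_mk (hf := AnalyticAt.fun_comp (f := fun y : ℂ => ((0, y) : ℂ × ℂ)) hf
      (AnalyticAt.prod analyticAt_const analyticAt_id))).1 hφ)
  refine ⟨mk q hq, ∑ j : Fin n, C (mk (a j) (ha j)) * X ^ (j : ℕ), degree_sum_fin_lt _, ?_⟩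
  have hr : ofPolynomial (∑ j : Fin n, C (mk (a j) (ha j)) * X ^ (j : ℕ)) =
      mk (fun z => ∑ j ∈ Finset.range n, a j z.1 * z.2 ^ j) (by
        refine Finset.analyticAt_fun_sum _ fun j _ => ?_
        exact (AnalyticAt.fun_comp (f := fun z : ℂ × ℂ => z.1) (ha j) analyticAt_fst).mul
          (analyticAt_snd.pow j)) := by
    have hj : ∀ j, ofPolynomial (C (mk (a j) (ha j)) * X ^ j) =
        mk (fun z => a j z.1 * z.2 ^ j)
          ((AnalyticAt.fun_comp (f := fun z : ℂ × ℂ => z.1) (ha j) analyticAt_fst).mul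
            (analyticAt_snd.pow j)) := by
      intro j
      rw [map_mul, map_pow, ofPolynomial_C, ofPolynomial_X]
      rfl
    rw [map_sum, Fin.sum_univ_eq_sum_range
      (fun j => ofPolynomial (C (mk (a j) (ha j)) * X ^ j)) n]
    simp only [hj]
    rw [mk_sum]
  rw [hr, mk_mul, mk_add]
  exact mk_eq_mk.2 h

/-- The preparation theorem follows from the division of `y ^ k` by `f`. -/
theorem isWeierstrass :
    IsWeierstrass coord (ofPolynomial : (analyticGerms ℂ)[X] →+* analyticGerms (ℂ × ℂ)) := by
  have hdist : ∀ P : (analyticGerms ℂ)[X], P.IsDistinguishedAt (Ideal.span {coord}) →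
      restrict (ofPolynomial P) = coord ^ P.natDegree := by
    intro P hP
    have h : P.map (value : analyticGerms ℂ →ₐ[ℂ] ℂ).toRingHom = X ^ P.natDegree := by
      ext i
      rw [coeff_map, coeff_X_pow]
      split_ifs with hi
      · rw [hi, hP.monic.coeff_natDegree, map_one]
      · rcases lt_or_gt_of_ne hi with hlt | hgt
        · exact coord_dvd_iff.1 (Ideal.mem_span_singleton.1 (hP.mem hlt))
        · rw [coeff_eq_zero_of_natDegree_lt hgt, map_zero]
    rw [restrict_ofPolynomial, h, map_pow, aeval_X]
  -- a polynomial of degree less than `n` is not divisible by `y ^ n` modulo `x`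
  have hlow : ∀ (n : ℕ) (r : (analyticGerms ℂ)[X]), r.degree < n →
      coord ^ n ∣ restrict (ofPolynomial r) →
      r.map (value : analyticGerms ℂ →ₐ[ℂ] ℂ).toRingHom = 0 := by
    intro n r hr hdvd
    rw [restrict_ofPolynomial, pow_dvd_aeval_iff irreducible_coord] at hdvd
    refine eq_zero_of_dvd_of_degree_lt hdvd ?_
    rw [degree_X_pow]
    exact degree_map_le.trans_lt hr
  refine ⟨fun N hN => ?_, fun f hf => ?_, fun f u k hu hk => ?_, fun P hP g => ?_,
    fun P hP r hr => ?_⟩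
  · change IsUnit (ofPolynomial N)
    rw [isUnit_iff, ← value_restrict, restrict_ofPolynomial, ← aeval_algHom_apply, value_coord,
      coe_aeval_eq_eval, ← coeff_zero_eq_eval_zero, coeff_map]
    exact isUnit_iff.1 hN
  · change ¬ ofPolynomial (C coord) ∣ f at hf
    rw [ofPolynomial_C_coord, fst_dvd_iff] at hf
    obtain ⟨k, u, hu, hk⟩ := exists_eq_pow_mul hf
    refine ⟨k, comp Prod.snd analyticAt_snd rfl u, hu.map _, ?_⟩
    change ofPolynomial (C coord) ∣ f - ofPolynomial X ^ k * _
    rw [ofPolynomial_C_coord, ofPolynomial_X, fst_dvd_iff, map_sub, map_mul, map_pow, restrict_snd,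
      hk, sub_eq_zero]
    congr 1
    obtain ⟨g, hg, rfl⟩ := exists_mk u
    rfl
  · change ofPolynomial (C coord) ∣ f - ofPolynomial X ^ k * u at hk
    change ∃ P : (analyticGerms ℂ)[X], _ ∧ _ ∧ Associated f (ofPolynomial P)
    rw [ofPolynomial_C_coord, ofPolynomial_X, fst_dvd_iff, map_sub, map_mul, map_pow, restrict_snd,
      sub_eq_zero] at hk
    obtain ⟨q, r, hr, h⟩ := exists_eq_mul_add (hu.map restrict) hk (snd ^ k)
    have h' := congrArg restrict h
    rw [map_add, map_mul, map_pow, restrict_snd, hk] at h'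
    have hr0 := hlow k r hr ⟨1 - restrict q * restrict u, by linear_combination -h'⟩
    rw [restrict_ofPolynomial, hr0, map_zero, add_zero] at h'
    have hqu : restrict q * restrict u = 1 := by
      have := coord_pow_mul_eq_zero (φ := restrict q * restrict u - 1) k
        (by linear_combination -h')
      exact sub_eq_zero.1 this
    have hq : IsUnit q := by
      rw [isUnit_iff, ← value_restrict, ← isUnit_iff]
      exact IsUnit.of_mul_eq_one _ hqu
    have hdeg : (X ^ k - r).natDegree = k := by
      have h1 : (X ^ k - r : (analyticGerms ℂ)[X]).degree = (k : WithBot ℕ) := by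
        rw [degree_sub_eq_left_of_degree_lt (by rwa [degree_X_pow]), degree_X_pow]
      exact natDegree_eq_of_degree_eq_some h1
    refine ⟨X ^ k - r, ⟨⟨fun {i} hi => ?_⟩, monic_X_pow_sub hr⟩, hdeg, ?_⟩
    · rw [hdeg] at hi
      rw [coeff_sub, coeff_X_pow, if_neg hi.ne, zero_sub, neg_mem_iff, Ideal.mem_span_singleton,
        coord_dvd_iff]
      have := congrArg (fun p => p.coeff i) hr0
      simpa using this
    · refine ⟨hq.unit, ?_⟩
      rw [map_sub ofPolynomial (X ^ k) r, map_pow, ofPolynomial_X, h, IsUnit.unit_spec]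
      ring
  · obtain ⟨q, r, -, h⟩ := exists_eq_mul_add (φ := ofPolynomial P) isUnit_one
      (by rw [hdist P hP, mul_one]) g
    exact ⟨r, q, by rw [h]; change _ - ofPolynomial r = ofPolynomial P * q; ring⟩
  · change ofPolynomial P ∣ ofPolynomial r at hr
    rw [← modByMonic_eq_zero_iff_dvd hP.monic]
    by_contra hne
    obtain ⟨k, N, hN, hNd⟩ := exists_eq_C_pow_mul irreducible_coord hne
    have hdegN : N.degree < P.natDegree := by
      rw [← degree_eq_natDegree hP.monic.ne_zero]
      refine lt_of_le_of_lt ?_ (degree_modByMonic_lt r hP.monic)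
      rw [hN, degree_mul, degree_pow, degree_C irreducible_coord.ne_zero, nsmul_zero, zero_add]
    have hdvd : ofPolynomial P ∣ fst ^ k * ofPolynomial N := by
      rw [← ofPolynomial_C_coord, ← map_pow, ← map_mul, ← hN, modByMonic_eq_sub_mul_div,
        map_sub ofPolynomial r (P * (r /ₘ P)), map_mul]
      exact dvd_sub hr (dvd_mul_right _ _)
    have cancel : ∀ k : ℕ, ofPolynomial P ∣ fst ^ k * ofPolynomial N →
        ofPolynomial P ∣ ofPolynomial N := by
      intro k
      induction k with
      | zero => simp
      | succ k ih =>
        rintro ⟨q, hq⟩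
        have h0 := congrArg restrict hq
        rw [map_mul, map_mul, map_pow, restrict_fst, zero_pow k.succ_ne_zero, zero_mul,
          hdist P hP] at h0
        obtain ⟨q', rfl⟩ := fst_dvd_iff.2 (coord_pow_mul_eq_zero _ h0.symm)
        exact ih ⟨q', fst_mul_cancel (by linear_combination hq)⟩
    obtain ⟨q, hq⟩ := cancel k hdvd
    have hN0 := hlow _ N hdegN ⟨restrict q, by rw [hq, map_mul, hdist P hP]⟩
    refine hNd ((C_dvd_iff_dvd_coeff _ _).2 fun i => coord_dvd_iff.2 ?_)
    have := congrArg (fun p => p.coeff i) hN0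
    simpa using this

end analyticGerms

/-! ### Local coordinates on a surface -/

namespace SurfaceGerm

variable {S : Type*} [TopologicalSpace S] [ChartedSpace Model S] {s : S}

/-- The germ at `s` of a holomorphic function. -/
def localRing.mk (f : S → ℂ) (hf : ContMDiffAt 𝓘(ℂ, Model) 𝓘(ℂ, ℂ) ω f s) : localRing s :=
  ⟨f, f, hf, rfl⟩

theorem localRing.exists_mk (φ : localRing s) :
    ∃ (f : S → ℂ) (hf : ContMDiffAt 𝓘(ℂ, Model) 𝓘(ℂ, ℂ) ω f s), φ = localRing.mk f hf := by
  obtain ⟨_, f, hf, rfl⟩ := φ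
  exact ⟨f, hf, rfl⟩

theorem localRing.mk_eq_mk {f g : S → ℂ} {hf : ContMDiffAt 𝓘(ℂ, Model) 𝓘(ℂ, ℂ) ω f s}
    {hg : ContMDiffAt 𝓘(ℂ, Model) 𝓘(ℂ, ℂ) ω g s} :
    localRing.mk f hf = localRing.mk g hg ↔ f =ᶠ[𝓝 s] g := by
  rw [Subtype.ext_iff]
  exact Filter.Germ.coe_eq

theorem mk_mem_maxIdeal_iff {f : S → ℂ} {hf : ContMDiffAt 𝓘(ℂ, Model) 𝓘(ℂ, ℂ) ω f s} :
    localRing.mk f hf ∈ maxIdeal s ↔ f s = 0 := Iff.rfl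

theorem IsLocalCoordinates.left_mem {x y : localRing s} (h : IsLocalCoordinates x y) :
    x ∈ maxIdeal s := by
  rw [← show _ = maxIdeal s from h]
  exact Ideal.subset_span (Set.mem_insert _ _)

theorem IsLocalCoordinates.right_mem {x y : localRing s} (h : IsLocalCoordinates x y) :
    y ∈ maxIdeal s := by
  rw [← show _ = maxIdeal s from h]
  exact Ideal.subset_span (Set.mem_insert_of_mem _ rfl)

theorem contDiffAt_comp_chart_symm {f : S → ℂ} (hf : ContMDiffAt 𝓘(ℂ, Model) 𝓘(ℂ, ℂ) ω f s) :
    ContDiffAt ℂ ω (f ∘ (extChartAt 𝓘(ℂ, Model) s).symm) (extChartAt 𝓘(ℂ, Model) s s) := by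
  have h := (contMDiffAt_iff.1 hf).2
  rw [ModelWithCorners.range_eq_univ, contDiffWithinAt_univ] at h
  exact h

theorem eventually_chart_symm_apply (s : S) : ∀ᶠ q in 𝓝 s,
    (extChartAt 𝓘(ℂ, Model) s).symm (extChartAt 𝓘(ℂ, Model) s q) = q := by
  filter_upwards [extChartAt_source_mem_nhds (I := 𝓘(ℂ, Model)) s] with q hq
  exact (extChartAt 𝓘(ℂ, Model) s).left_inv hq

/-- The coordinates of a chart, as germs of holomorphic functions vanishing at `s`. -/
theorem contMDiffAt_chart_coord (s : S) (i : Fin 2) : ContMDiffAt 𝓘(ℂ, Model) 𝓘(ℂ, ℂ) ω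
    (fun q => extChartAt 𝓘(ℂ, Model) s q i - extChartAt 𝓘(ℂ, Model) s s i) s := by
  have h1 : ContMDiffAt 𝓘(ℂ, Model) 𝓘(ℂ, ℂ) ω
      (fun z : Model => z i - extChartAt 𝓘(ℂ, Model) s s i) (extChartAt 𝓘(ℂ, Model) s s) :=
    ContDiffAt.contMDiffAt (by fun_prop)
  exact h1.comp s contMDiffAt_extChartAt

theorem hasFDerivAt_chart_coord (s : S) (i : Fin 2) :
    HasFDerivAt ((fun q => extChartAt 𝓘(ℂ, Model) s q i - extChartAt 𝓘(ℂ, Model) s s i) ∘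
      (extChartAt 𝓘(ℂ, Model) s).symm) (EuclideanSpace.proj i : Model →L[ℂ] ℂ)
      (extChartAt 𝓘(ℂ, Model) s s) := by
  refine ((EuclideanSpace.proj i : Model →L[ℂ] ℂ).hasFDerivAt.sub_const
    (extChartAt 𝓘(ℂ, Model) s s i)).congr_of_eventuallyEq ?_
  filter_upwards [extChartAt_target_mem_nhds (I := 𝓘(ℂ, Model)) s] with z hz
  simp only [Function.comp_apply]
  rw [(extChartAt 𝓘(ℂ, Model) s).right_inv hz]
  rfl

/-- Functions which generate the maximal ideal have independent differentials, since each
coordinate of a chart is a combination of them. -/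
theorem injective_fderiv_of_isLocalCoordinates {f g : S → ℂ}
    (hf : ContMDiffAt 𝓘(ℂ, Model) 𝓘(ℂ, ℂ) ω f s) (hg : ContMDiffAt 𝓘(ℂ, Model) 𝓘(ℂ, ℂ) ω g s)
    (h : IsLocalCoordinates (localRing.mk f hf) (localRing.mk g hg)) {F' G' : Model →L[ℂ] ℂ}
    (hF' : HasFDerivAt (f ∘ (extChartAt 𝓘(ℂ, Model) s).symm) F' (extChartAt 𝓘(ℂ, Model) s s))
    (hG' : HasFDerivAt (g ∘ (extChartAt 𝓘(ℂ, Model) s).symm) G' (extChartAt 𝓘(ℂ, Model) s s))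
    {v : Model} (hFv : F' v = 0) (hGv : G' v = 0) : v = 0 := by
  set φ := extChartAt 𝓘(ℂ, Model) s with hφ
  have hsymm : φ.symm (φ s) = s := extChartAt_to_inv s
  have hf0 : f s = 0 := h.left_mem
  have hg0 : g s = 0 := h.right_mem
  ext i
  have hc := contMDiffAt_chart_coord s i
  have hmem : localRing.mk _ hc ∈ maxIdeal s := mk_mem_maxIdeal_iff.2 (sub_self _)
  rw [← show _ = maxIdeal s from h, Ideal.mem_span_pair] at hmem
  obtain ⟨a, b, hab⟩ := hmem
  obtain ⟨a, ha, rfl⟩ := localRing.exists_mk a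
  obtain ⟨b, hb, rfl⟩ := localRing.exists_mk b
  have hab' : (a * f + b * g : S → ℂ) =ᶠ[𝓝 s] fun q => φ q i - φ s i :=
    (localRing.mk_eq_mk (hf := (ha.mul hf).add (hb.mul hg))).1 hab
  have htend : Filter.Tendsto φ.symm (𝓝 (φ s)) (𝓝 s) := by
    have := continuousAt_extChartAt_symm (I := 𝓘(ℂ, Model)) s
    rwa [ContinuousAt, ← hφ, hsymm] at this
  have hz : (fun q => φ q i - φ s i) ∘ φ.symm =ᶠ[𝓝 (φ s)]
      fun z => (a ∘ φ.symm) z * (f ∘ φ.symm) z + (b ∘ φ.symm) z * (g ∘ φ.symm) z :=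
    (htend.eventually hab').mono fun z hz => hz.symm
  have hA := (contDiffAt_comp_chart_symm ha).differentiableAt (by simp) |>.hasFDerivAt
  have hB := (contDiffAt_comp_chart_symm hb).differentiableAt (by simp) |>.hasFDerivAt
  have hd := ((hA.mul hF').add (hB.mul hG')).congr_of_eventuallyEq hz
  have hd' := hasFDerivAt_chart_coord s i
  have := congrArg (fun L : Model →L[ℂ] ℂ => L v) (hd'.unique hd)
  have hF0 : (f ∘ φ.symm) (φ s) = 0 := (congrArg f hsymm).trans hf0
  have hG0 : (g ∘ φ.symm) (φ s) = 0 := (congrArg g hsymm).trans hg0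
  rw [hF0, hG0] at this
  simpa [hFv, hGv] using this

/-- Functions with independent differentials define an isomorphism with the algebra of germs at the
origin of the plane, by the inverse function theorem. -/
theorem exists_algEquiv_of_fderiv {f g : S → ℂ}
    (hf : ContMDiffAt 𝓘(ℂ, Model) 𝓘(ℂ, ℂ) ω f s) (hg : ContMDiffAt 𝓘(ℂ, Model) 𝓘(ℂ, ℂ) ω g s)
    (hf0 : f s = 0) (hg0 : g s = 0)
    (h : ∀ v : Model,
      fderiv ℂ (f ∘ (extChartAt 𝓘(ℂ, Model) s).symm) (extChartAt 𝓘(ℂ, Model) s s) v = 0 →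
      fderiv ℂ (g ∘ (extChartAt 𝓘(ℂ, Model) s).symm) (extChartAt 𝓘(ℂ, Model) s s) v = 0 → v = 0) :
    ∃ e : localRing s ≃ₐ[ℂ] analyticGerms (ℂ × ℂ),
      e (localRing.mk f hf) = analyticGerms.fst ∧ e (localRing.mk g hg) = analyticGerms.snd := by
  set φ := extChartAt 𝓘(ℂ, Model) s with hφ
  have hsymm : φ.symm (φ s) = s := extChartAt_to_inv s
  have hF := contDiffAt_comp_chart_symm hf
  have hG := contDiffAt_comp_chart_symm hg
  have hF' := (hF.differentiableAt (by simp)).hasFDerivAt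
  have hG' := (hG.differentiableAt (by simp)).hasFDerivAt
  set H : Model → ℂ × ℂ := fun z => (f (φ.symm z), g (φ.symm z)) with hH
  have hHc : ContDiffAt ℂ ω H (φ s) := hF.prodMk hG
  have hH' := hF'.prodMk hG'
  set L := (fderiv ℂ (f ∘ φ.symm) (φ s)).prod (fderiv ℂ (g ∘ φ.symm) (φ s)) with hL
  have hinj : Function.Injective L := by
    refine (injective_iff_map_eq_zero L).2 fun v hv => ?_
    exact h v (congrArg Prod.fst hv) (congrArg Prod.snd hv)
  let L' : Model ≃L[ℂ] ℂ × ℂ :=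
    (LinearEquiv.ofInjectiveOfFinrankEq (L : Model →ₗ[ℂ] ℂ × ℂ) hinj
      (by simp)).toContinuousLinearEquiv
  have hL' : (L' : Model →L[ℂ] ℂ × ℂ) = L := by ext v <;> rfl
  have hHL : HasFDerivAt H (L' : Model →L[ℂ] ℂ × ℂ) (φ s) := by rw [hL']; exact hH'
  have hω : (ω : WithTop ℕ∞) ≠ 0 := by simp
  have hstr := hHc.hasStrictFDerivAt' hHL hω
  have hH0 : H (φ s) = 0 := by simp [hH, hsymm, hf0, hg0]
  let K := hHc.localInverse hHL hω
  have hK0 : K 0 = φ s := by rw [← hH0]; exact hHc.localInverse_apply_image hHL hω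
  have hKc : ContDiffAt ℂ ω K 0 := by rw [← hH0]; exact hHc.to_localInverse hHL hω
  have hHK : ∀ᶠ z in 𝓝 (0 : ℂ × ℂ), H (K z) = z := by
    rw [← hH0]; exact hstr.eventually_right_inverse
  have hKH : ∀ᶠ z in 𝓝 (φ s), K (H z) = z := hstr.eventually_left_inverse
  have hsymmt : Filter.Tendsto φ.symm (𝓝 (φ s)) (𝓝 s) := by
    have := continuousAt_extChartAt_symm (I := 𝓘(ℂ, Model)) s
    rwa [ContinuousAt, ← hφ, hsymm] at this
  have hKt : Filter.Tendsto K (𝓝 0) (𝓝 (φ s)) := by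
    have := hKc.continuousAt.tendsto
    rwa [hK0] at this
  have hφt : Filter.Tendsto φ (𝓝 s) (𝓝 (φ s)) := (continuousAt_extChartAt s).tendsto
  have hfgt : Filter.Tendsto (fun q => (f q, g q)) (𝓝 s) (𝓝 (0 : ℂ × ℂ)) := by
    have := (hf.continuousAt.prodMk hg.continuousAt).tendsto
    rwa [hf0, hg0] at this
  let E₁ : localRing s →ₐ[ℂ] analyticGerms (ℂ × ℂ) :=
    AlgHom.codRestrict ((germComp (φ.symm ∘ K) (hsymmt.comp hKt)).comp (localRing s).val)
      (analyticGerms (ℂ × ℂ)) (by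
        rintro ⟨_, a, ha, rfl⟩
        refine ⟨(a ∘ φ.symm) ∘ K, ContDiffAt.analyticAt ?_, rfl⟩
        exact ContDiffAt.comp 0 (by rw [hK0]; exact contDiffAt_comp_chart_symm ha) hKc)
  let E₂ : analyticGerms (ℂ × ℂ) →ₐ[ℂ] localRing s :=
    AlgHom.codRestrict ((germComp (fun q => (f q, g q)) hfgt).comp (analyticGerms (ℂ × ℂ)).val)
      (localRing s) (by
        rintro ⟨_, a, ha, rfl⟩
        refine ⟨a ∘ fun q => (f q, g q), ?_, rfl⟩
        refine ContMDiffAt.comp (I' := 𝓘(ℂ, ℂ × ℂ)) s (ContDiffAt.contMDiffAt ?_)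
          (hf.prodMk_space hg)
        rw [hf0, hg0]
        exact ha.contDiffAt)
  have h₁ : E₁.comp E₂ = AlgHom.id ℂ _ := by
    ext a
    obtain ⟨a, ha, rfl⟩ := analyticGerms.exists_mk a
    refine Filter.Germ.coe_eq.2 ?_
    filter_upwards [hHK] with z hz
    exact congrArg a hz
  have h₂ : E₂.comp E₁ = AlgHom.id ℂ _ := by
    ext a
    obtain ⟨a, ha, rfl⟩ := localRing.exists_mk a
    refine Filter.Germ.coe_eq.2 ?_
    filter_upwards [hφt.eventually hKH, eventually_chart_symm_apply s] with q hq hqs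
    have : K (f q, g q) = φ q := by
      rw [← hq]
      simp only [hH]
      rw [hqs]
    change a (φ.symm (K (f q, g q))) = a q
    rw [this, hqs]
  refine ⟨AlgEquiv.ofAlgHom E₁ E₂ h₁ h₂, ?_, ?_⟩
  · refine Subtype.ext (Filter.Germ.coe_eq.2 ?_)
    filter_upwards [hHK] with z hz
    exact congrArg Prod.fst hz
  · refine Subtype.ext (Filter.Germ.coe_eq.2 ?_)
    filter_upwards [hHK] with z hz
    exact congrArg Prod.snd hz

theorem IsLocalCoordinates.exists_algEquiv {x y : localRing s} (h : IsLocalCoordinates x y) :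
    ∃ e : localRing s ≃ₐ[ℂ] analyticGerms (ℂ × ℂ),
      e x = analyticGerms.fst ∧ e y = analyticGerms.snd := by
  obtain ⟨f, hf, rfl⟩ := localRing.exists_mk x
  obtain ⟨g, hg, rfl⟩ := localRing.exists_mk y
  refine exists_algEquiv_of_fderiv hf hg h.left_mem h.right_mem fun v => ?_
  exact injective_fderiv_of_isLocalCoordinates hf hg h
    ((contDiffAt_comp_chart_symm hf).differentiableAt (by simp)).hasFDerivAt
    ((contDiffAt_comp_chart_symm hg).differentiableAt (by simp)).hasFDerivAt

theorem evalHom_algebraMap (s : S) (c : ℂ) : evalHom s (algebraMap ℂ (localRing s) c) = c := by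
  rw [Algebra.algebraMap_eq_smul_one]
  change ((c • (1 : S → ℂ)) : S → ℂ) s = c
  simp

/-- Every isomorphism is compatible with the values at the base points, because a germ which
vanishes at the base point is not invertible. -/
theorem value_algEquiv (e : localRing s ≃ₐ[ℂ] analyticGerms (ℂ × ℂ)) (a : localRing s) :
    analyticGerms.value (e a) = evalHom s a := by
  have h : ¬ IsUnit (a - algebraMap ℂ (localRing s) (evalHom s a)) := fun h => by
    have := (h.map (evalHom s)).ne_zero
    rw [map_sub, evalHom_algebraMap, sub_self] at this
    exact this rfl
  have h' := mt (fun hu => (MulEquiv.isUnit_map e).1 hu) h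
  rw [analyticGerms.isUnit_iff, not_not, map_sub, map_sub, AlgEquiv.commutes, AlgHom.commutes,
    sub_eq_zero] at h'
  exact h'

theorem isUnit_iff_evalHom_ne_zero (e : localRing s ≃ₐ[ℂ] analyticGerms (ℂ × ℂ))
    {a : localRing s} : IsUnit a ↔ evalHom s a ≠ 0 := by
  rw [← value_algEquiv e, ← analyticGerms.isUnit_iff, MulEquiv.isUnit_map]

theorem isLocalCoordinates_of_algEquiv (e : localRing s ≃ₐ[ℂ] analyticGerms (ℂ × ℂ))
    {x y : localRing s} (hx : e x = analyticGerms.fst) (hy : e y = analyticGerms.snd) :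
    IsLocalCoordinates x y := by
  have hmem : ∀ a : localRing s, a ∈ maxIdeal s ↔ analyticGerms.value (e a) = 0 := fun a => by
    rw [value_algEquiv]
    exact RingHom.mem_ker
  refine le_antisymm (Ideal.span_le.2 ?_) fun a ha => ?_
  · rintro _ (rfl | rfl)
    · exact (hmem _).2 (by rw [hx]; rfl)
    · exact (hmem _).2 (by rw [hy]; rfl)
  · rw [hmem, ← analyticGerms.value_restrict, ← analyticGerms.coord_dvd_iff] at ha
    obtain ⟨b, hb⟩ := ha
    have h1 : analyticGerms.fst ∣ e a -
        analyticGerms.snd * analyticGerms.comp Prod.snd analyticAt_snd rfl b := by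
      rw [analyticGerms.fst_dvd_iff, map_sub, map_mul, analyticGerms.restrict_snd, hb, sub_eq_zero]
      congr 1
      obtain ⟨b, hb, rfl⟩ := analyticGerms.exists_mk b
      rfl
    obtain ⟨c, hc⟩ := h1
    rw [Ideal.mem_span_pair]
    refine ⟨e.symm c, e.symm (analyticGerms.comp Prod.snd analyticAt_snd rfl b), e.injective ?_⟩
    rw [map_add, map_mul, map_mul, e.apply_symm_apply, e.apply_symm_apply, hx, hy]
    linear_combination -hc

theorem exists_isLocalCoordinates (s : S) : ∃ x y : localRing s, IsLocalCoordinates x y := by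
  obtain ⟨e, hx, hy⟩ := exists_algEquiv_of_fderiv (contMDiffAt_chart_coord s 0)
    (contMDiffAt_chart_coord s 1) (sub_self _) (sub_self _) (fun v h0 h1 => by
      rw [(hasFDerivAt_chart_coord s 0).fderiv] at h0
      rw [(hasFDerivAt_chart_coord s 1).fderiv] at h1
      ext i
      fin_cases i
      · exact h0
      · exact h1)
  exact ⟨_, _, isLocalCoordinates_of_algEquiv e hx hy⟩

end SurfaceGerm

/-! ### Smooth branches and multiplicities -/

theorem IsWeierstrass.comp_ringEquiv {D R R' : Type*} [CommRing D] [CommRing R] [CommRing R']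
    {π : D} {Ψ : D[X] →+* R} (h : IsWeierstrass π Ψ) (e : R ≃+* R') :
    IsWeierstrass π ((e : R →+* R').comp Ψ) := by
  have hdvd : ∀ a b, e a ∣ b ↔ a ∣ e.symm b := fun a b => by
    rw [← map_dvd_iff e (a := a), e.apply_symm_apply]
  refine ⟨fun N hN => (h.isUnit_map N hN).map e, fun f hf => ?_, fun f u k hu hk => ?_,
    fun P hP g => ?_, fun P hP r hr => h.dvd_of_map_dvd P hP r ?_⟩
  · obtain ⟨k, u, hu, hk⟩ := h.exists_order (e.symm f) (fun hd => hf ((hdvd _ _).2 hd))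
    refine ⟨k, e u, hu.map e, (hdvd _ _).2 ?_⟩
    simpa using hk
  · obtain ⟨P, hP, hPk, hass⟩ := h.preparation (e.symm f) (e.symm u) k (hu.map e.symm) (by
      have := (hdvd _ _).1 hk
      simpa using this)
    refine ⟨P, hP, hPk, ?_⟩
    have := hass.map (e : R →* R')
    simpa using this
  · obtain ⟨r, hr⟩ := h.division P hP (e.symm g)
    refine ⟨r, (hdvd _ _).2 ?_⟩
    simpa using hr
  · have := (hdvd _ _).1 hr
    simpa using this

theorem analyticGerms.irreducible_fst : Irreducible fst := by
  have key : ∀ φ ψ, fst = φ * ψ → restrict φ = 0 → IsUnit ψ := by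
    intro φ ψ h hφ
    obtain ⟨c, rfl⟩ := fst_dvd_iff.2 hφ
    refine IsUnit.of_mul_eq_one c (fst_mul_cancel ?_)
    rw [mul_one]
    conv_rhs => rw [h]
    ring
  refine ⟨fun h => isUnit_iff.1 h rfl, fun φ ψ h => ?_⟩
  have h0 := congrArg restrict h
  rw [restrict_fst, map_mul, eq_comm, mul_eq_zero] at h0
  rcases h0 with h0 | h0
  · exact Or.inr (key φ ψ h h0)
  · exact Or.inl (key ψ φ (h.trans (mul_comm _ _)) h0)

namespace SurfaceGerm

variable {S : Type*} [TopologicalSpace S] [ChartedSpace Model S] {s : S}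

namespace IsLocalCoordinates

variable {x y : localRing s}

/-- The Weierstrass theorems in the local ring, with respect to local coordinates. -/
theorem exists_isWeierstrass (h : IsLocalCoordinates x y) :
    ∃ Ψ : (analyticGerms ℂ)[X] →ₐ[ℂ] localRing s,
      IsWeierstrass analyticGerms.coord (Ψ : (analyticGerms ℂ)[X] →+* localRing s) ∧
        Ψ (C analyticGerms.coord) = x ∧ Ψ X = y := by
  obtain ⟨e, hx, hy⟩ := h.exists_algEquiv
  refine ⟨(e.symm : analyticGerms (ℂ × ℂ) →ₐ[ℂ] localRing s).comp analyticGerms.ofPolynomial,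
    analyticGerms.isWeierstrass.comp_ringEquiv e.symm.toRingEquiv, ?_, ?_⟩
  · rw [AlgHom.comp_apply, analyticGerms.ofPolynomial_C_coord, ← hx]
    exact e.symm_apply_apply x
  · rw [AlgHom.comp_apply, analyticGerms.ofPolynomial_X, ← hy]
    exact e.symm_apply_apply y

/-- The restriction of germs to the smooth branch `Z(x)`, parametrized by `y`. -/
theorem exists_restrict (h : IsLocalCoordinates x y) :
    ∃ ρ : localRing s →ₐ[ℂ] analyticGerms ℂ, ρ x = 0 ∧ ρ y = analyticGerms.coord ∧
      ∀ f, x ∣ f ↔ ρ f = 0 := by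
  obtain ⟨e, hx, hy⟩ := h.exists_algEquiv
  refine ⟨analyticGerms.restrict.comp (e : localRing s →ₐ[ℂ] analyticGerms (ℂ × ℂ)), ?_, ?_,
    fun f => ?_⟩
  · change analyticGerms.restrict (e x) = 0
    rw [hx, analyticGerms.restrict_fst]
  · change analyticGerms.restrict (e y) = _
    rw [hy, analyticGerms.restrict_snd]
  · change _ ↔ analyticGerms.restrict (e f) = 0
    rw [← analyticGerms.fst_dvd_iff, ← hx, map_dvd_iff]

theorem irreducible_left (h : IsLocalCoordinates x y) : Irreducible x := by
  obtain ⟨e, hx, hy⟩ := h.exists_algEquiv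
  rw [← MulEquiv.irreducible_iff e, hx]
  exact analyticGerms.irreducible_fst

theorem symm (h : IsLocalCoordinates x y) : IsLocalCoordinates y x := by
  rw [IsLocalCoordinates, Ideal.span_pair_comm]
  exact h

/-- Every line through the origin other than `y = 0` is part of a coordinate system. -/
theorem sub_smul (h : IsLocalCoordinates x y) (c : ℂ) : IsLocalCoordinates (x - c • y) y := by
  rw [IsLocalCoordinates, ← show _ = maxIdeal s from h, Algebra.smul_def,
    Ideal.span_pair_sub_mul_right]

theorem not_dvd_right (h : IsLocalCoordinates x y) : ¬ x ∣ y := by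
  obtain ⟨ρ, -, hy, hρ⟩ := h.exists_restrict
  rw [hρ, hy]
  exact analyticGerms.irreducible_coord.ne_zero

end IsLocalCoordinates

theorem isUnit_iff {a : localRing s} : IsUnit a ↔ evalHom s a ≠ 0 := by
  obtain ⟨x, y, h⟩ := exists_isLocalCoordinates s
  obtain ⟨e, -, -⟩ := h.exists_algEquiv
  exact isUnit_iff_evalHom_ne_zero e

theorem _root_.Irreducible.mem_maxIdeal {f : localRing s} (hf : Irreducible f) :
    f ∈ maxIdeal s := by
  by_contra h
  exact hf.not_isUnit (isUnit_iff.2 h)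

theorem _root_.Irreducible.exists_isLocalCoordinates {f : localRing s} (hf : Irreducible f) :
    ∃ x y : localRing s, IsLocalCoordinates x y ∧ ¬ x ∣ f := by
  obtain ⟨x, y, h⟩ := SurfaceGerm.exists_isLocalCoordinates s
  by_cases hx : x ∣ f
  · refine ⟨y, x, h.symm, fun hy => h.not_dvd_right ?_⟩
    exact ((h.irreducible_left.associated_of_dvd hf hx).trans
      (h.symm.irreducible_left.associated_of_dvd hf hy).symm).dvd
  · exact ⟨x, y, h, hx⟩

/-- The multiplicity at `s` is at most the order along the smooth branch `Z(x)`. -/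
theorem IsLocalCoordinates.coord_pow_dvd {x y : localRing s} (h : IsLocalCoordinates x y)
    {ρ : localRing s →ₐ[ℂ] analyticGerms ℂ} (hx : ρ x = 0) (hy : ρ y = analyticGerms.coord)
    {f : localRing s} {k : ℕ} (hf : f ∈ maxIdeal s ^ k) : analyticGerms.coord ^ k ∣ ρ f := by
  have hle : (maxIdeal s).map ρ ≤ Ideal.span {analyticGerms.coord} := by
    rw [← show _ = maxIdeal s from h, Ideal.map_span, Ideal.span_le]
    rintro _ ⟨_, rfl | rfl, rfl⟩
    · rw [hx]
      exact zero_mem _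
    · rw [hy]
      exact Ideal.mem_span_singleton_self _
  have h1 := Ideal.mem_map_of_mem ρ hf
  rw [Ideal.map_pow] at h1
  have h2 := Ideal.pow_right_mono hle k h1
  rwa [Ideal.span_singleton_pow, Ideal.mem_span_singleton] at h2

/-- An irreducible germ has finite multiplicity. -/
theorem exists_mem_pow_notMem_pow {f : localRing s} (hf : Irreducible f) :
    ∃ k, k ≠ 0 ∧ f ∈ maxIdeal s ^ k ∧ f ∉ maxIdeal s ^ (k + 1) := by
  classical
  obtain ⟨x, y, h, hxf⟩ := hf.exists_isLocalCoordinates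
  obtain ⟨ρ, hx, hy, hρ⟩ := h.exists_restrict
  rw [hρ] at hxf
  obtain ⟨n, u, hu, hn⟩ := analyticGerms.exists_eq_pow_mul hxf
  have hex : ∃ k, f ∉ maxIdeal s ^ (k + 1) := by
    refine ⟨n, fun hmem => ?_⟩
    obtain ⟨v, hv⟩ := h.coord_pow_dvd hx hy hmem
    have h0 := analyticGerms.coord_pow_mul_eq_zero (φ := u - analyticGerms.coord * v) n
      (by linear_combination hv - hn)
    rw [sub_eq_zero] at h0
    exact analyticGerms.irreducible_coord.not_isUnit (isUnit_of_dvd_unit ⟨v, h0⟩ hu)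
  refine ⟨Nat.find hex, fun h0 => ?_, ?_, Nat.find_spec hex⟩
  · have := Nat.find_spec hex
    rw [h0, zero_add, pow_one] at this
    exact this hf.mem_maxIdeal
  · rcases hj : Nat.find hex with _ | j
    · rw [pow_zero, Ideal.one_eq_top]
      trivial
    · exact not_not.1 (Nat.find_min hex (m := j) (by omega))

theorem exists_eq_sum_of_mem_span_pair_pow {R : Type*} [CommRing R] {x y : R} {k : ℕ} {f : R}
    (hf : f ∈ Ideal.span {x, y} ^ k) :
    ∃ g : ℕ → R, f = ∑ i ∈ Finset.range (k + 1), g i * (x ^ i * y ^ (k - i)) := by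
  have hle : Ideal.span {x, y} ^ k ≤
      Ideal.span ((fun i => x ^ i * y ^ (k - i)) '' (Finset.range (k + 1) : Set ℕ)) := by
    clear hf
    induction k with
    | zero =>
      rw [pow_zero, Ideal.one_eq_top, top_le_iff, Ideal.eq_top_iff_one]
      exact Ideal.subset_span ⟨0, by simp⟩
    | succ k ih =>
      rw [pow_succ]
      refine (Ideal.mul_mono_left ih).trans ?_
      rw [Ideal.span_mul_span', Ideal.span_le]
      rintro _ ⟨_, ⟨i, hi, rfl⟩, _, rfl | rfl, rfl⟩
      · have hi' := Finset.mem_range.1 (Finset.mem_coe.1 hi)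
        refine Ideal.subset_span ⟨i + 1, Finset.mem_coe.2 (Finset.mem_range.2 (by omega)), ?_⟩
        simp only [Nat.add_sub_add_right]
        ring
      · have hi' := Finset.mem_range.1 (Finset.mem_coe.1 hi)
        refine Ideal.subset_span ⟨i, Finset.mem_coe.2 (Finset.mem_range.2 (by omega)), ?_⟩
        simp only [show k + 1 - i = k - i + 1 by omega]
        ring
  obtain ⟨g, hg⟩ := (Submodule.mem_span_image_finset_iff_exists_fun R).1 (hle hf)
  refine ⟨fun i => if hi : i ∈ Finset.range (k + 1) then g ⟨i, hi⟩ else 0, ?_⟩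
  refine hg.symm.trans (Eq.trans ?_ (Finset.sum_coe_sort (Finset.range (k + 1)) _))
  refine Finset.sum_congr rfl fun i _ => ?_
  simp only [dif_pos i.2, smul_eq_mul]

/-- Outside a finite set of directions, the order along a line is the multiplicity. The exceptional
directions are the zeros of the initial form. -/
theorem exists_initial_form {x y : localRing s} (h : IsLocalCoordinates x y) {f : localRing s}
    {k : ℕ} (hf : f ∈ maxIdeal s ^ k) (hf' : f ∉ maxIdeal s ^ (k + 1)) :
    ∃ P : ℂ[X], P ≠ 0 ∧ ∀ c : ℂ, P.eval c ≠ 0 →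
      ∃ u, IsUnit u ∧ (x - c • y) ∣ f - y ^ k * u := by
  rw [← show _ = maxIdeal s from h] at hf
  obtain ⟨g, rfl⟩ := exists_eq_sum_of_mem_span_pair_pow hf
  refine ⟨∑ i ∈ Finset.range (k + 1), C (evalHom s (g i)) * X ^ i, fun h0 => hf' ?_,
    fun c hc => ⟨∑ i ∈ Finset.range (k + 1), g i * algebraMap ℂ (localRing s) c ^ i, ?_, ?_⟩⟩
  · refine Ideal.sum_mem _ fun i hi => ?_
    have hgi : g i ∈ maxIdeal s := by
      have := congrArg (fun p : ℂ[X] => p.coeff i) h0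
      simp only [finsetSum_coeff, coeff_C_mul_X_pow, coeff_zero] at this
      rw [Finset.sum_ite_eq, if_pos hi] at this
      exact this
    rw [pow_succ']
    refine Ideal.mul_mem_mul hgi ?_
    have hik : i + (k - i) = k := by have := Finset.mem_range.1 hi; omega
    have := Ideal.mul_mem_mul (Ideal.pow_mem_pow h.left_mem i)
      (Ideal.pow_mem_pow h.right_mem (k - i))
    rwa [← pow_add, hik] at this
  · rw [isUnit_iff]
    simpa [evalHom_algebraMap, eval_finsetSum] using hc
  · rw [Finset.mul_sum, ← Finset.sum_sub_distrib]
    refine Finset.dvd_sum fun i hi => ?_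
    have hik : y ^ k = y ^ i * y ^ (k - i) := by
      rw [← pow_add]
      congr 1
      have := Finset.mem_range.1 hi
      omega
    have hd : x - c • y ∣ x ^ i - (c • y) ^ i := sub_dvd_pow_sub_pow _ _ _
    have : g i * (x ^ i * y ^ (k - i)) - y ^ k * (g i * algebraMap ℂ (localRing s) c ^ i) =
        (x ^ i - (c • y) ^ i) * (g i * y ^ (k - i)) := by
      rw [hik, Algebra.smul_def]
      ring
    rw [this]
    exact hd.mul_right _

end SurfaceGerm

/-! ### Ultrametrics on the set of branches -/

theorem isUltrametric_of_ne {M : Type*} {d : M → M → ℝ} (hself : ∀ a, d a a = 0)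
    (hpos : ∀ a b, a ≠ b → 0 < d a b) (hsymm : ∀ a b, d a b = d b a)
    (htri : ∀ a b c, a ≠ b → b ≠ c → a ≠ c → d a c ≤ max (d a b) (d b c)) : IsUltrametric d := by
  have hnonneg : ∀ a b, 0 ≤ d a b := fun a b => by
    by_cases h : a = b
    · rw [h, hself]
    · exact (hpos a b h).le
  have hmax : ∀ a b c, d a c ≤ max (d a b) (d b c) := fun a b c => by
    by_cases hab : a = b
    · rw [hab]
      exact le_max_right _ _
    by_cases hbc : b = c
    · rw [hbc]
      exact le_max_left _ _
    by_cases hac : a = c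
    · rw [hac, hself]
      exact (hnonneg _ _).trans (le_max_left _ _)
    exact htri a b c hab hbc hac
  let m : MetricSpace M :=
    { dist := d
      dist_self := hself
      dist_comm := hsymm
      dist_triangle := fun a b c =>
        (hmax a b c).trans (max_le_add_of_nonneg (hnonneg _ _) (hnonneg _ _))
      eq_of_dist_eq_zero := fun {a b} h => by
        by_contra hab
        exact (hpos a b hab).ne' h }
  exact ⟨m, fun _ _ => rfl, ⟨hmax⟩⟩

/-- Quotients `w a * w b / i a b` form an ultrametric if `i` satisfies the inequality which holds
for intersection numbers. -/
theorem isUltrametric_of_intersection {M : Type*} {d i : M → M → ℝ} {w : M → ℝ}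
    (hd : ∀ a b, a ≠ b → d a b = w a * w b / i a b) (hself : ∀ a, d a a = 0) (hw : ∀ a, 0 < w a)
    (hi : ∀ a b, a ≠ b → 0 < i a b) (hsymm : ∀ a b, i a b = i b a)
    (h : ∀ a b c, a ≠ b → b ≠ c → a ≠ c →
      i a b * w c ≤ i a c * w b ∨ i b c * w a ≤ i a c * w b) : IsUltrametric d := by
  refine isUltrametric_of_ne hself (fun a b hab => ?_) (fun a b => ?_)
    fun a b c hab hbc hac => ?_
  · rw [hd a b hab]
    exact div_pos (mul_pos (hw a) (hw b)) (hi a b hab)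
  · by_cases hab : a = b
    · rw [hab]
    · rw [hd a b hab, hd b a (Ne.symm hab), hsymm a b, mul_comm]
  · rw [hd a b hab, hd b c hbc, hd a c hac, le_max_iff, div_le_div_iff₀ (hi a c hac) (hi a b hab),
      div_le_div_iff₀ (hi a c hac) (hi b c hbc)]
    refine (h a b c hab hbc hac).imp (fun h => ?_) fun h => ?_
    · nlinarith [mul_le_mul_of_nonneg_left h (hw a).le]
    · nlinarith [mul_le_mul_of_nonneg_left h (hw c).le]

namespace SurfaceGerm

variable {S : Type*} [TopologicalSpace S] [ChartedSpace Model S] {s : S}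

namespace Branch

theorem exists_irreducible (A : Branch s) : ∃ f, Irreducible f ∧ A.1.ideal = Ideal.span {f} := by
  obtain ⟨f, hf, hirr⟩ := A.2
  exact ⟨f, hirr, hf⟩

theorem not_associated {A B : Branch s} (hAB : A ≠ B) {f g : localRing s}
    (hA : A.1.ideal = Ideal.span {f}) (hB : B.1.ideal = Ideal.span {g}) : ¬ Associated f g := by
  refine fun h => hAB (Subtype.ext (CurveSingularity.ext ?_))
  rw [hA, hB, span_singleton_eq_of_associated h]

theorem not_dvd {A B : Branch s} (hAB : A ≠ B) {f g : localRing s}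
    (hf : Irreducible f) (hg : Irreducible g)
    (hA : A.1.ideal = Ideal.span {f}) (hB : B.1.ideal = Ideal.span {g}) : ¬ f ∣ g :=
  fun h => not_associated hAB hA hB (hf.associated_of_dvd hg h)

theorem inter_comm (A B : Branch s) : A.inter B = B.inter A := by
  rw [inter, inter, CurveSingularity.inter, CurveSingularity.inter, sup_comm]

theorem inter_eq_interNumber {A B : Branch s} (hAB : A ≠ B) {f g : localRing s}
    (hf : Irreducible f) (hg : Irreducible g)
    (hA : A.1.ideal = Ideal.span {f}) (hB : B.1.ideal = Ideal.span {g}) :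
    A.inter B = interNumber f g ∧ interNumber f g ≠ 0 := by
  obtain ⟨x, y, h, hxf⟩ := hf.exists_isLocalCoordinates
  obtain ⟨Ψ, hΨ, rfl, -⟩ := h.exists_isWeierstrass
  have hfin := hΨ.finite_quotient analyticGerms.irreducible_coord analyticGerms.exists_coord_dvd_sub
    hf hxf (not_dvd hAB hf hg hA hB)
  constructor
  · rw [inter, CurveSingularity.inter, hA, hB, ← Module.finrank_eq_rank, Cardinal.toENat_nat]
    rfl
  · have hne : Ideal.span {f} ⊔ Ideal.span {g} ≠ ⊤ := by
      intro htop
      have hle : Ideal.span {f} ⊔ Ideal.span {g} ≤ maxIdeal s :=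
        sup_le ((Ideal.span_singleton_le_iff_mem _).2 hf.mem_maxIdeal)
          ((Ideal.span_singleton_le_iff_mem _).2 hg.mem_maxIdeal)
      rw [htop, top_le_iff] at hle
      exact RingHom.ker_ne_top (evalHom s) hle
    have : Nontrivial (localRing s ⧸ (Ideal.span {f} ⊔ Ideal.span {g})) :=
      Ideal.Quotient.nontrivial_iff.2 hne
    exact Module.finrank_pos.ne'

theorem inter_ne_zero {A B : Branch s} (hAB : A ≠ B) : A.inter B ≠ 0 := by
  obtain ⟨f, hf, hA⟩ := A.exists_irreducible
  obtain ⟨g, hg, hB⟩ := B.exists_irreducible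
  obtain ⟨h, h0⟩ := inter_eq_interNumber hAB hf hg hA hB
  rw [h]
  exact_mod_cast h0

theorem inter_ne_top {A B : Branch s} (hAB : A ≠ B) : A.inter B ≠ ⊤ := by
  obtain ⟨f, hf, hA⟩ := A.exists_irreducible
  obtain ⟨g, hg, hB⟩ := B.exists_irreducible
  rw [(inter_eq_interNumber hAB hf hg hA hB).1]
  exact ENat.natCast_ne_top _

theorem mult_eq {A : Branch s} {f : localRing s} (hA : A.1.ideal = Ideal.span {f}) {k : ℕ}
    (hk : f ∈ maxIdeal s ^ k) (hk' : f ∉ maxIdeal s ^ (k + 1)) : A.mult = k := by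
  rw [mult, CurveSingularity.multiplicity_eq hA]
  refine le_antisymm (sSup_le ?_) (le_sSup ⟨k, rfl, hk⟩)
  rintro _ ⟨j, rfl, hj⟩
  rw [Nat.cast_le]
  by_contra! hlt
  exact hk' (Ideal.pow_le_pow_right hlt hj)

/-- The multiplicity is the intersection number with all but finitely many of the lines
`x = c y`. -/
theorem exists_mult_eq_inter {x y : localRing s} (h : IsLocalCoordinates x y) (A : Branch s) :
    ∃ P : ℂ[X], P ≠ 0 ∧ ∀ c : ℂ, P.eval c ≠ 0 → ∀ L : Branch s,
      L.1.ideal = Ideal.span {x - c • y} → A ≠ L ∧ A.mult = L.inter A := by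
  obtain ⟨f, hf, hA⟩ := A.exists_irreducible
  obtain ⟨k, -, hk, hk'⟩ := exists_mem_pow_notMem_pow hf
  obtain ⟨P, hP, hPc⟩ := exists_initial_form h hk hk'
  refine ⟨P, hP, fun c hc L hL => ?_⟩
  obtain ⟨u, hu, hdvd⟩ := hPc c hc
  have hc' := h.sub_smul c
  have hx := hc'.irreducible_left
  have hne : A ≠ L := by
    rintro rfl
    have hd : x - c • y ∣ f :=
      Ideal.span_singleton_le_span_singleton.1 (hA.symm.trans hL).le
    obtain ⟨ρ, -, hy, hρ⟩ := hc'.exists_restrict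
    have h1 := (hρ _).1 hdvd
    rw [map_sub, (hρ f).1 hd, zero_sub, neg_eq_zero, map_mul, map_pow, hy] at h1
    exact (hu.map ρ).ne_zero (analyticGerms.coord_pow_mul_eq_zero k h1)
  refine ⟨hne, ?_⟩
  obtain ⟨Ψ, hΨ, hΨx, rfl⟩ := hc'.exists_isWeierstrass
  rw [mult_eq hA hk hk', inter_comm, (inter_eq_interNumber hne hf hx hA hL).1, ← hΨx,
    hΨ.interNumber_eq_order analyticGerms.irreducible_coord analyticGerms.exists_coord_dvd_sub hf
      hu (by rw [hΨx]; exact hdvd)]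

theorem mult_ne_zero (A : Branch s) : A.mult ≠ 0 := by
  obtain ⟨f, hf, hA⟩ := A.exists_irreducible
  obtain ⟨k, hk0, hk, hk'⟩ := exists_mem_pow_notMem_pow hf
  rw [mult_eq hA hk hk']
  exact_mod_cast hk0

theorem mult_ne_top (A : Branch s) : A.mult ≠ ⊤ := by
  obtain ⟨f, hf, hA⟩ := A.exists_irreducible
  obtain ⟨k, hk0, hk, hk'⟩ := exists_mem_pow_notMem_pow hf
  rw [mult_eq hA hk hk']
  exact ENat.natCast_ne_top _

end Branch

theorem real_pos {n : ℕ∞} (h0 : n ≠ 0) (h : n ≠ ⊤) : 0 < real n := by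
  rw [real, Nat.cast_pos, Nat.pos_iff_ne_zero]
  exact fun h1 => (ENat.toNat_eq_zero.1 h1).elim h0 h

/-- The ultrametric inequality for the intersection numbers with a smooth branch `L`, cleared of
denominators. -/
theorem inter_mul_inter_le {L A B C : Branch s} (hL : L.1.IsSmooth) (hAL : A ≠ L) (hBL : B ≠ L)
    (hCL : C ≠ L) (hAB : A ≠ B) (hBC : B ≠ C) (hAC : A ≠ C) :
    real (A.inter B) * real (L.inter C) ≤ real (A.inter C) * real (L.inter B) ∨
      real (B.inter C) * real (L.inter A) ≤ real (A.inter C) * real (L.inter B) := by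
  obtain ⟨x, y, h, hLx : L.1.ideal = Ideal.span {x}⟩ := hL
  have hx := h.irreducible_left
  obtain ⟨Ψ, hΨ, rfl, -⟩ := h.exists_isWeierstrass
  obtain ⟨f₁, hf₁, hA⟩ := A.exists_irreducible
  obtain ⟨f₂, hf₂, hB⟩ := B.exists_irreducible
  obtain ⟨f₃, hf₃, hC⟩ := C.exists_irreducible
  have key := hΨ.interNumber_ultrametric analyticGerms.irreducible_coord
    analyticGerms.exists_coord_dvd_sub hf₁ hf₂ hf₃
    (Branch.not_dvd hAL.symm hx hf₁ hLx hA) (Branch.not_dvd hBL.symm hx hf₂ hLx hB)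
    (Branch.not_dvd hCL.symm hx hf₃ hLx hC) (Branch.not_associated hAB hA hB)
    (Branch.not_associated hBC hB hC) (Branch.not_associated hAC hA hC)
  rw [(Branch.inter_eq_interNumber hAB hf₁ hf₂ hA hB).1,
    (Branch.inter_eq_interNumber hBC hf₂ hf₃ hB hC).1,
    (Branch.inter_eq_interNumber hAC hf₁ hf₃ hA hC).1,
    (Branch.inter_eq_interNumber hAL.symm hx hf₁ hLx hA).1,
    (Branch.inter_eq_interNumber hBL.symm hx hf₂ hLx hB).1,
    (Branch.inter_eq_interNumber hCL.symm hx hf₃ hLx hC).1]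
  simp only [real, ENat.toNat_natCast]
  exact_mod_cast key

/-- A smooth branch which is transversal to three given branches reduces the theorem of Płoski
to the inequality for a smooth branch. -/
theorem inter_mul_mult_le {A B C : Branch s} (hAB : A ≠ B) (hBC : B ≠ C) (hAC : A ≠ C) :
    real (A.inter B) * real C.mult ≤ real (A.inter C) * real B.mult ∨
      real (B.inter C) * real A.mult ≤ real (A.inter C) * real B.mult := by
  obtain ⟨x, y, h⟩ := exists_isLocalCoordinates s
  obtain ⟨P, hP, hA⟩ := Branch.exists_mult_eq_inter h A
  obtain ⟨Q, hQ, hB⟩ := Branch.exists_mult_eq_inter h B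
  obtain ⟨T, hT, hC⟩ := Branch.exists_mult_eq_inter h C
  obtain ⟨c, hc⟩ := Infinite.exists_notMem_finset (P * Q * T).roots.toFinset
  rw [Multiset.mem_toFinset, mem_roots (mul_ne_zero (mul_ne_zero hP hQ) hT), IsRoot.def, eval_mul,
    eval_mul, mul_eq_zero, mul_eq_zero, not_or, not_or] at hc
  have hc' := h.sub_smul c
  have hx := hc'.irreducible_left
  let L : Branch s := ⟨⟨Ideal.span {x - c • y}, _, hx.mem_maxIdeal,
    fun h0 => hc'.symm.not_dvd_right (h0 ▸ dvd_zero _), rfl⟩, _, rfl, hx⟩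
  obtain ⟨hAL, hA⟩ := hA c hc.1.1 L rfl
  obtain ⟨hBL, hB⟩ := hB c hc.1.2 L rfl
  obtain ⟨hCL, hC⟩ := hC c hc.2 L rfl
  rw [hA, hB, hC]
  exact inter_mul_inter_le ⟨_, _, hc', rfl⟩ hAL hBL hCL hAB hBC hAC

theorem isUltrametric_u {L : Branch s} (hL : L.1.IsSmooth) : IsUltrametric (u L) := by
  refine isUltrametric_of_intersection (i := fun A B => real (A.1.inter B.1))
    (w := fun A => real (L.inter A.1)) (fun A B hAB => if_neg hAB) (fun A => if_pos rfl)
    (fun A => real_pos (Branch.inter_ne_zero A.2.symm) (Branch.inter_ne_top A.2.symm))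
    (fun A B hAB => ?_) (fun A B => by rw [Branch.inter_comm]) fun A B C hAB hBC hAC => ?_
  · have := Subtype.coe_ne_coe.2 hAB
    exact real_pos (Branch.inter_ne_zero this) (Branch.inter_ne_top this)
  · exact inter_mul_inter_le hL A.2 B.2 C.2 (Subtype.coe_ne_coe.2 hAB) (Subtype.coe_ne_coe.2 hBC)
      (Subtype.coe_ne_coe.2 hAC)

theorem isUltrametric_ploski : IsUltrametric (ploski (s := s)) :=
  isUltrametric_of_intersection (i := fun A B => real (A.inter B)) (w := fun A => real A.mult)
    (fun _ _ hAB => if_neg hAB) (fun _ => if_pos rfl)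
    (fun A => real_pos A.mult_ne_zero A.mult_ne_top)
    (fun _ _ hAB => real_pos (Branch.inter_ne_zero hAB) (Branch.inter_ne_top hAB))
    (fun A B => by rw [Branch.inter_comm]) fun _ _ _ => inter_mul_mult_le

theorem quot_comm (A B : Branch s) : quot A B = quot B A := by
  rw [quot, quot, Branch.inter_comm, mul_comm (real A.mult)]

theorem min_quot_le {A B C : Branch s} (hAB : A ≠ B) (hBC : B ≠ C) (hAC : A ≠ C) :
    min (quot A B) (quot B C) ≤ quot A C := by
  have hpos : ∀ A : Branch s, 0 < real A.mult := fun A => real_pos A.mult_ne_zero A.mult_ne_top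
  have hA := hpos A
  have hB := hpos B
  have hC := hpos C
  rw [min_le_iff, quot, quot, quot, div_le_div_iff₀ (mul_pos hA hB) (mul_pos hA hC),
    div_le_div_iff₀ (mul_pos hB hC) (mul_pos hA hC)]
  refine (inter_mul_mult_le hAB hBC hAC).imp (fun h => ?_) fun h => ?_
  · nlinarith [mul_le_mul_of_nonneg_left h hA.le]
  · nlinarith [mul_le_mul_of_nonneg_left h hC.le]

/-- Of the three quotients, the two smallest are equal. -/
theorem quot_trichotomy {A B C : Branch s} (hAB : A ≠ B) (hBC : B ≠ C) (hCA : C ≠ A) :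
    (quot A B ≥ quot B C ∧ quot B C = quot C A) ∨ (quot B C ≥ quot C A ∧ quot C A = quot A B) ∨
      (quot C A ≥ quot A B ∧ quot A B = quot B C) := by
  have h₁ := min_quot_le hAB hBC hCA.symm
  have h₂ := min_quot_le hBC hCA hAB.symm
  have h₃ := min_quot_le hCA hAB hBC.symm
  rw [quot_comm A C] at h₁
  rw [quot_comm B A] at h₂
  rw [quot_comm C B] at h₃
  rcases le_total (quot A B) (quot B C) with h | h <;>
  rcases le_total (quot B C) (quot C A) with h' | h' <;>
  rcases le_total (quot C A) (quot A B) with h'' | h'' <;>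
  simp only [min_eq_left, min_eq_right, h, h', h''] at h₁ h₂ h₃ <;>
  first
  | exact Or.inl ⟨by linarith, by linarith⟩
  | exact Or.inr (Or.inl ⟨by linarith, by linarith⟩)
  | exact Or.inr (Or.inr ⟨by linarith, by linarith⟩)

end SurfaceGerm

theorem theorem4p1 {S : Type*} [TopologicalSpace S] [ChartedSpace SurfaceGerm.Model S]
    [IsManifold 𝓘(ℂ, SurfaceGerm.Model) ω S] (s : S) :
    -- the numbers entering the functions below are finite and positive
    (∀ A B : SurfaceGerm.Branch s, A ≠ B → A.inter B ≠ 0 ∧ A.inter B ≠ ⊤) ∧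
    (∀ A : SurfaceGerm.Branch s, A.mult ≠ 0 ∧ A.mult ≠ ⊤) ∧
    -- `u_L` is an ultrametric for every smooth branch `L`
    (∀ L : SurfaceGerm.Branch s, L.1.IsSmooth → IsUltrametric (SurfaceGerm.u L)) ∧
    -- the consequence: the theorem of Płoski, in its ultrametric form and in its original form
    IsUltrametric (SurfaceGerm.ploski (s := s)) ∧
    (∀ A B C : SurfaceGerm.Branch s, A ≠ B → B ≠ C → C ≠ A →
      (SurfaceGerm.quot A B ≥ SurfaceGerm.quot B C ∧
        SurfaceGerm.quot B C = SurfaceGerm.quot C A) ∨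
      (SurfaceGerm.quot B C ≥ SurfaceGerm.quot C A ∧
        SurfaceGerm.quot C A = SurfaceGerm.quot A B) ∨
      (SurfaceGerm.quot C A ≥ SurfaceGerm.quot A B ∧
        SurfaceGerm.quot A B = SurfaceGerm.quot B C)) :=
  ⟨fun _ _ hAB => ⟨SurfaceGerm.Branch.inter_ne_zero hAB, SurfaceGerm.Branch.inter_ne_top hAB⟩,
    fun A => ⟨A.mult_ne_zero, A.mult_ne_top⟩,
    fun _ hL => SurfaceGerm.isUltrametric_u hL,
    SurfaceGerm.isUltrametric_ploski,
    fun _ _ _ hAB hBC hCA => SurfaceGerm.quot_trichotomy hAB hBC hCA⟩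

end
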